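/- **Conventions.** For a formal power series, $[x^j]$ denotes extraction of the coefficient of $x^j$, and $(2j-1)!! = \frac{(2j)!}{2^j j!}$ for $j\ge 0$. All identities are identities of formal power series. The *excess* of a graph or multigraph is its number of edges minus its number of vertices. *Graphs* are simple graphs with labelled vertices; a family $\mathcal F$ of graphs has generating function $F(z,w)=\sum_{G\in\mathcal F} w^{m(G)}\frac{z^{n(G)}}{n(G)!}$, where $n(G)$, $m(G)$ are the numbers of vertices and edges. *Multigraphs* have labelled vertices and labelled oriented edges, loops and multiple edges being allowed; a family $\mathcal F$ of multigraphs has generating function $F(z,w)=\sum_{G\in\mathcal F}\frac{w^{m(G)}}{2^{m(G)}m(G)!}\frac{z^{n(G)}}{n(G)!}$. (Vertex labels are $1,\dots,n(G)$ and edge labels $1,\dots,m(G)$.) In both cases $F_k(z)=[y^k]F(z/y,y)$ is the generating function of the members of $\mathcal F$ of excess $k$. Let $\mathrm{SG}^{>0}$ (resp. $\mathrm{MG}^{>0}$) be the family of graphs (resp. multigraphs) all of whose connected components have positive excess. In a multigraph, a *loop* is a subgraph consisting of one vertex and one edge from it to itself, and a *double edge* is a subgraph consisting of two distinct vertices and two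 distinct edges (of any orientations) linking them. A *patchwork* is a set $P=\{(V_1,E_1),\dots,(V_p,E_p)\}$ of pairs (vertices, edges) such that $\mathrm{MG}(P)=(\bigcup_i V_i,\bigcup_i E_i)$ is a multigraph and each $(V_i,E_i)$ is a loop or a double edge of $\mathrm{MG}(P)$. Put $|P|=p$, and let $n(P)$, $m(P)$ be the numbers of vertices and edges of $\mathrm{MG}(P)$. Let $$P(z,w,u)=\sum_{P\text{ patchwork}} u^{|P|}\frac{w^{m(P)}}{2^{m(P)}m(P)!}\frac{z^{n(P)}}{n(P)!},\qquad P_\ell(z,u)=[y^\ell]P(z/y,y,u),$$ so that $P_\ell$ is the generating function of the patchworks of excess $\ell$. Let $T(z)$, $\mathit{MV}(z)$, $V(z)$ (the generating functions of rooted trees, of connected multigraphs of excess $0$ and of connected graphs of excess $0$) be the series given by $$T(z)=z e^{T(z)},\qquad \mathit{MV}(z)=\tfrac12\log\frac1{1-T(z)},\qquad V(z)=\mathit{MV}(z)-\tfrac12T(z)-\tfrac14T(z)^2 .$$ **Lemma.** For every integer $k\ge 0$, the generating function of graphs of excess $k$ all of whose components have positive excess is $$\mathrm{SG}^{>0}_k(z)=\sum_{\ell=0}^{k}(2(k-\ell)-1)!!\,[x^{2(k-\ell)}]\,\frac{P_\ell(T(z)e^x,-1)\,e^{-V(z)}}{\Big(1-T(z)\frac{e^x-1-x}{x^2/2}\Big)^{k-\ell+1/2}}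 .$$ The generating function of multigraphs of excess $k$ all of whose components have positive excess is $$\mathrm{MG}^{>0}_k(z)=(2k-1)!!\,[x^{2k}]\,\frac{e^{-\mathit{MV}(z)}}{\Big(1-T(z)\frac{e^x-1-x}{x^2/2}\Big)^{k+1/2}},$$ and $\mathrm{SG}^{>0}_k$ is coefficientwise at most $\mathrm{MG}^{>0}_k$: $[z^n]\mathrm{SG}^{>0}_k(z)\le[z^n]\mathrm{MG}^{>0}_k(z)$ for all $n\ge 0$. -/

import Mathlib

open scoped PowerSeries

namespace ExcessGF

/-! ### Generating functions in two variables

A series `F(z,w) = ∑ a_{n,m} zⁿ wᵐ` is an element of `R⟦X⟧⟦X⟧`: the outer variable is `z`, the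
inner one is the second variable (`w`, or `x` in the closed formulas). -/

/-- `F_k(z) = [y^k] F(z/y, y)`: the monomial `zⁿ wᵐ` becomes `zⁿ y^(m-n)`, so the coefficient of
`zⁿ` in `F_k` is the coefficient of `zⁿ w^(n+k)` in `F`. -/
noncomputable def excessPart {R : Type*} [Semiring R] (k : ℕ) (F : R⟦X⟧⟦X⟧) : R⟦X⟧ :=
  PowerSeries.mk fun n => PowerSeries.coeff (n + k) (PowerSeries.coeff n F)

/-- `[x^j] G(z,x)`, a series in `z`. -/
noncomputable def innerCoeff {R : Type*} [Semiring R] (j : ℕ) (G : R⟦X⟧⟦X⟧) : R⟦X⟧ :=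
  PowerSeries.mk fun n => PowerSeries.coeff j (PowerSeries.coeff n G)

/-! ### Graphs -/

/-- Number of edges minus number of vertices of a (simple) graph. -/
noncomputable def graphExcess {V : Type*} (G : SimpleGraph V) : ℤ :=
  (G.edgeSet.ncard : ℤ) - (Nat.card V : ℤ)

/-- Every connected component has positive excess. -/
def GraphPos {V : Type*} (G : SimpleGraph V) : Prop :=
  ∀ c : G.ConnectedComponent, 0 < graphExcess c.toSimpleGraph

/-- Generating function `∑_{G ∈ 𝓕} w^{m(G)} z^{n(G)} / n(G)!` of a family of labelled graphs; the
graphs with `n` vertices have vertex set `Fin n`. -/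
noncomputable def graphGF (𝓕 : ∀ n : ℕ, Set (SimpleGraph (Fin n))) : ℚ⟦X⟧⟦X⟧ :=
  PowerSeries.mk fun n => PowerSeries.mk fun m =>
    ({G : SimpleGraph (Fin n) | G ∈ 𝓕 n ∧ G.edgeSet.ncard = m}.ncard : ℚ) / (n.factorial : ℚ)

/-- `SG^{>0}_k(z)`. -/
noncomputable def sgPos (k : ℕ) : ℚ⟦X⟧ :=
  excessPart k (graphGF fun _ => {G | GraphPos G})

/-! ### Multigraphs -/

/-- A multigraph with labelled vertices (`V`) and labelled oriented edges: the edge with label `e`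
is the triple `((G e).1, (G e).2, e)`. Loops and multiple edges are allowed. -/
abbrev Multigraph (V E : Type*) := E → V × V

namespace Multigraph

/-- Number of edges minus number of vertices. -/
noncomputable def excess {V E : Type*} (_G : Multigraph V E) : ℤ :=
  (Nat.card E : ℤ) - (Nat.card V : ℤ)

/-- The adjacency graph, used to speak of connected components. -/
def support {V E : Type*} (G : Multigraph V E) : SimpleGraph V :=
  SimpleGraph.fromRel fun v w => ∃ e, G e = (v, w)

/-- The sub-multigraph on the vertex set `S`, with all edges having both ends in `S`. -/
def induce {V E : Type*} (G : Multigraph V E) (S : Set V) :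
    Multigraph S {e : E // (G e).1 ∈ S ∧ (G e).2 ∈ S} :=
  fun e => (⟨(G e.1).1, e.2.1⟩, ⟨(G e.1).2, e.2.2⟩)

/-- Every connected component has positive excess. -/
def Pos {V E : Type*} (G : Multigraph V E) : Prop :=
  ∀ c : G.support.ConnectedComponent, 0 < (G.induce c.supp).excess

/-- The subgraph with vertices `p.1` and edges (given by labels) `p.2` is a loop of `G`. -/
def IsLoop {V E : Type*} [DecidableEq V] [DecidableEq E] (G : Multigraph V E)
    (p : Finset V × Finset E) : Prop :=
  ∃ (v : V) (e : E), G e = (v, v) ∧ p = ({v}, {e})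

/-- The subgraph with vertices `p.1` and edges `p.2` is a double edge of `G`: two distinct edges,
of any orientations, linking the same two distinct vertices. -/
def IsDoubleEdge {V E : Type*} [DecidableEq V] [DecidableEq E] (G : Multigraph V E)
    (p : Finset V × Finset E) : Prop :=
  ∃ (v w : V) (e f : E), v ≠ w ∧ e ≠ f ∧ (G e = (v, w) ∨ G e = (w, v)) ∧
    (G f = (v, w) ∨ G f = (w, v)) ∧ p = ({v, w}, {e, f})

end Multigraph

/-- Generating function `∑_{G ∈ 𝓕} w^{m(G)} / (2^{m(G)} m(G)!) * z^{n(G)} / n(G)!` of a family of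
multigraphs; vertices are labelled by `Fin n` and edges by `Fin m`. -/
noncomputable def multigraphGF (𝓕 : ∀ n m : ℕ, Set (Multigraph (Fin n) (Fin m))) : ℚ⟦X⟧⟦X⟧ :=
  PowerSeries.mk fun n => PowerSeries.mk fun m =>
    ((𝓕 n m).ncard : ℚ) / (2 ^ m * (m.factorial : ℚ) * (n.factorial : ℚ))

/-- `MG^{>0}_k(z)`. -/
noncomputable def mgPos (k : ℕ) : ℚ⟦X⟧ :=
  excessPart k (multigraphGF fun _ _ => {G | G.Pos})

/-! ### Patchworks -/

/-- `P` is a patchwork with `MG(P) = G`: a set of loops and double edges of `G` whose vertex sets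
and edge sets cover `G`. (The multigraph `G` is determined by the parts, a part being a set of
vertices and a set of edges, i.e. of triples; recording `G` allows one to give an edge by its
label.) -/
def IsPatchwork {V E : Type*} [DecidableEq V] [DecidableEq E] (G : Multigraph V E)
    (P : Finset (Finset V × Finset E)) : Prop :=
  (∀ p ∈ P, G.IsLoop p ∨ G.IsDoubleEdge p) ∧
    (∀ v : V, ∃ p ∈ P, v ∈ p.1) ∧ (∀ e : E, ∃ p ∈ P, e ∈ p.2)

open Classical in
/-- `P(z,w,u) = ∑_P u^{|P|} w^{m(P)} / (2^{m(P)} m(P)!) * z^{n(P)} / n(P)!`, the sum being over all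
patchworks, as a series in `z` and `w` whose coefficients are polynomials in `u`. -/
noncomputable def patchworkGF : (Polynomial ℚ)⟦X⟧⟦X⟧ :=
  PowerSeries.mk fun n => PowerSeries.mk fun m =>
    ∑ GP : Multigraph (Fin n) (Fin m) × Finset (Finset (Fin n) × Finset (Fin m)) with
        IsPatchwork GP.1 GP.2,
      Polynomial.monomial GP.2.card
        (1 / (2 ^ m * (m.factorial : ℚ) * (n.factorial : ℚ)) : ℚ)

/-- `P_ℓ(z,u)`, the generating function of patchworks of excess `ℓ`. -/
noncomputable def patchworkPart (l : ℕ) : (Polynomial ℚ)⟦X⟧ :=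
  excessPart l patchworkGF

/-- `P_ℓ(z,u)` at a rational value of `u`. -/
noncomputable def patchworkPartAt (l : ℕ) (u : ℚ) : ℚ⟦X⟧ :=
  PowerSeries.map (Polynomial.evalRingHom u) (patchworkPart l)

/-! ### The series in the closed formulas -/

/-- `z * e^(-z)`. -/
noncomputable def treeInv : ℚ⟦X⟧ :=
  PowerSeries.X * PowerSeries.evalNegHom (PowerSeries.exp ℚ)

theorem constantCoeff_treeInv : PowerSeries.constantCoeff treeInv = 0 := by
  simp [treeInv]

theorem coeff_one_treeInv : PowerSeries.coeff 1 treeInv = 1 := by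
  rw [treeInv]
  simp [PowerSeries.evalNegHom]

theorem isUnit_coeff_one_treeInv : IsUnit (PowerSeries.coeff 1 treeInv) := by
  rw [coeff_one_treeInv]
  exact isUnit_one

/-- `T(z)`: the compositional inverse of `z * e^(-z)`, that is, the unique series with
`T = z * e^T` (see `tree_eq` and `tree_unique`). -/
noncomputable def tree : ℚ⟦X⟧ :=
  treeInv.substInvOfIsUnit isUnit_coeff_one_treeInv

theorem constantCoeff_tree : PowerSeries.constantCoeff tree = 0 :=
  PowerSeries.constantCoeff_substInvOfIsUnit _ _

theorem treeInv_subst_mul_exp (S : ℚ⟦X⟧) (hS : PowerSeries.constantCoeff S = 0) :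
    treeInv.subst S * (PowerSeries.exp ℚ).subst S = S := by
  have hs : PowerSeries.HasSubst S := PowerSeries.HasSubst.of_constantCoeff_zero' hS
  rw [← PowerSeries.subst_mul hs, treeInv, mul_assoc,
    mul_comm (PowerSeries.evalNegHom (PowerSeries.exp ℚ)),
    PowerSeries.exp_mul_exp_neg_eq_one, mul_one, PowerSeries.subst_X hs]

theorem tree_eq : tree = PowerSeries.X * (PowerSeries.exp ℚ).subst tree := by
  have h := treeInv_subst_mul_exp tree constantCoeff_tree
  have h2 : treeInv.subst tree = (PowerSeries.X : ℚ⟦X⟧) :=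
    PowerSeries.subst_substInvOfIsUnit_right treeInv constantCoeff_treeInv _
  rw [h2] at h
  exact h.symm

theorem tree_unique (S : ℚ⟦X⟧) (hS : S = PowerSeries.X * (PowerSeries.exp ℚ).subst S) :
    S = tree := by
  have h0 : PowerSeries.constantCoeff S = 0 := by
    rw [hS]
    simp
  have hs : PowerSeries.HasSubst S := PowerSeries.HasSubst.of_constantCoeff_zero' h0
  have hi : PowerSeries.HasSubst treeInv :=
    PowerSeries.HasSubst.of_constantCoeff_zero' constantCoeff_treeInv
  have h1 := treeInv_subst_mul_exp S h0
  have hne : (PowerSeries.exp ℚ).subst S ≠ (0 : ℚ⟦X⟧) := by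
    intro h
    have h3 := PowerSeries.subst_mul hs (PowerSeries.exp ℚ)
      (PowerSeries.evalNegHom (PowerSeries.exp ℚ))
    rw [PowerSeries.exp_mul_exp_neg_eq_one, h, zero_mul, ← PowerSeries.coe_substAlgHom hs,
      map_one] at h3
    exact one_ne_zero h3
  have h2 : treeInv.subst S = (PowerSeries.X : ℚ⟦X⟧) :=
    mul_right_cancel₀ hne (h1.trans hS)
  have h4 : tree.subst treeInv = (PowerSeries.X : ℚ⟦X⟧) :=
    PowerSeries.subst_substInvOfIsUnit_left treeInv constantCoeff_treeInv _
  have h5 := PowerSeries.subst_comp_subst_apply hi hs tree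
  rw [h4, h2, PowerSeries.subst_X hs, PowerSeries.X_subst] at h5
  exact h5

/-- `MV(z) = (1/2) log (1 / (1 - T(z)))`. -/
noncomputable def multiUnicycle : ℚ⟦X⟧ :=
  (1 / 2 : ℚ) • PowerSeries.logOf ((1 - tree)⁻¹)

/-- `V(z) = MV(z) - T(z)/2 - T(z)²/4`. -/
noncomputable def unicycle : ℚ⟦X⟧ :=
  multiUnicycle - (1 / 2 : ℚ) • tree - (1 / 4 : ℚ) • tree ^ 2

/-- `(e^x - 1 - x) / (x²/2)`. -/
noncomputable def expQuot : ℚ⟦X⟧ :=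
  PowerSeries.mk fun n => 2 / ((n + 2).factorial : ℚ)

theorem expQuot_spec :
    (1 / 2 : ℚ) • PowerSeries.X ^ 2 * expQuot = PowerSeries.exp ℚ - 1 - PowerSeries.X := by
  ext n
  rcases n with _ | _ | n
  · simp [mul_comm, PowerSeries.coeff_zero_eq_constantCoeff]
  · simp [PowerSeries.coeff_X_pow_mul', PowerSeries.coeff_one]
  · simp [PowerSeries.coeff_X_pow_mul', expQuot, PowerSeries.coeff_one, PowerSeries.coeff_X,
      PowerSeries.coeff_exp]
    field_simp

/-- `(2j-1)!! = (2j)! / (2^j j!)`. -/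
def oddDoubleFactorial (j : ℕ) : ℚ :=
  ((2 * j).factorial : ℚ) / (2 ^ j * (j.factorial : ℚ))

/-- A series in `z` alone, seen as a series in `z` and `x`. -/
noncomputable def inZ (F : ℚ⟦X⟧) : ℚ⟦X⟧⟦X⟧ := PowerSeries.map PowerSeries.C F

/-- A series in `x` alone, seen as a series in `z` and `x`. -/
noncomputable def inX (F : ℚ⟦X⟧) : ℚ⟦X⟧⟦X⟧ := PowerSeries.C F

/-- `(1 - T(z) (e^x-1-x)/(x²/2))^a` for a rational exponent `a`, through the binomial series
`(1 + t)^a = ∑ (a choose n) tⁿ`. -/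
noncomputable def denomPow (a : ℚ) : ℚ⟦X⟧⟦X⟧ :=
  (PowerSeries.binomialSeries ℚ a).subst (-(inZ tree * inX expQuot))

/-- `P_ℓ(T(z) e^x, -1)`. -/
noncomputable def patchworkSubst (l : ℕ) : ℚ⟦X⟧⟦X⟧ :=
  (patchworkPartAt l (-1)).subst (inZ tree * inX (PowerSeries.exp ℚ))

end ExcessGF

open scoped PowerSeries

namespace ExcessGF
open PowerSeries

/-! Let `z` mark vertices and `w` edges. There are `n^(2m)` multigraphs with `n` vertices and `m`
edges, so their series is `∑ e^(wn²/2) zⁿ/n!`, that is `E[exp(z e^x)]` for a formal centred Gaussian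
`x` of variance `w` (`gauss`). Put `z = s e^(-ws)`, solved by `s = T(zw)/w` (`scaledTree`).
Completing the square recentres the Gaussian: the series becomes `exp(s - ws²/2)`, which counts
forests, times `E[exp(s(e^x-1-x))]`. As `e^x-1-x` starts with `x²/2`, expanding the last factor in
`s` grades it by excess, and its part of excess `k` is `(2k-1)!! [x^(2k)] (1 -
T(e^x-1-x)/(x²/2))^(-k-1/2)`. This is `shiftedMultigraphs_eq`, which also carries a weight `e^(ax)`
needed for graphs.

Trees and unicyclic components are never enumerated. Separating the components of positive excess
from the others factors the series as `P * N`, where apart from the constant 1 all monomials `zⁿwᵐ`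
of `P` have `m > n`, while those of `N` have `m ≤ n`. Such a factorization is unique
(`positive_factor_unique`), so `P` is obtained by dividing the graded factor by its part of excess
0, which a differential equation identifies as `e^MV`.

A graph with `m` edges corresponds to `2^m m!` simple multigraphs. Inclusion and exclusion over sets
of loops and double edges counts these: such a set is a patchwork on the vertices and edges it
covers, and the remaining edges are free. With `W` the patchwork series at `u = -1`, this is
`IsCorrection W`; it writes the graph series as `∑ W_a(w) z^a shiftedMultigraphs a`, to which the
same tree substitution applies. One also needs that `W` has no monomial of negative excess and that
its part of excess 0 is `e^(-z/2-z²/4)`. Both follow from finite differences in `n` of the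
polynomials `[w^m] (1+w)^(n(n-1)/2) e^(-wn²/2)`, without examining the shape of patchworks.

The inequality holds because simple multigraphs are among all multigraphs, with the same weights. -/

/-- Coefficients of a substitution as a finite sum. -/
theorem coeff_subst_eq_sum {A B : Type*} [CommRing A] [CommRing B] [Algebra A B] {g : B⟦X⟧}
    (hg : constantCoeff g = 0) (f : A⟦X⟧) {n N : ℕ} (h : n < N) :
    coeff n (f.subst g) = ∑ d ∈ Finset.range N, coeff d f • coeff n (g ^ d) := by
  rw [coeff_subst' (HasSubst.of_constantCoeff_zero' hg)]
  apply finsum_eq_sum_of_support_subset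
  intro d hd
  simp only [Finset.coe_range, Set.mem_Iio]
  by_contra hc
  apply hd
  change coeff d f • coeff n (g ^ d) = 0
  rw [coeff_of_lt_order n (φ := g ^ d), smul_zero]
  have h1 : (d : ℕ∞) ≤ (g ^ d).order := by
    have := le_order_pow_of_constantCoeff_eq_zero d hg
    exact this
  refine lt_of_lt_of_le ?_ h1
  exact_mod_cast (by omega : n < d)

theorem constantCoeff_subst_eq {A B : Type*} [CommRing A] [CommRing B] [Algebra A B] {g : B⟦X⟧}
    (hg : constantCoeff g = 0) (f : A⟦X⟧) :
    constantCoeff (f.subst g) = algebraMap A B (constantCoeff f) := by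
  rw [← coeff_zero_eq_constantCoeff_apply, coeff_subst_eq_sum hg f (zero_lt_one)]
  simp [Algebra.smul_def]

/-! ### Exponentials of series over a `ℚ`-algebra. -/

section Exponential

variable {A : Type*} [CommRing A] [Algebra ℚ A]

theorem constantCoeff_exp_subst {f : A⟦X⟧} (hf : constantCoeff f = 0) :
    constantCoeff ((exp A).subst f : A⟦X⟧) = 1 := by
  rw [constantCoeff_subst_eq hf]
  simp

theorem derivative_exp_subst {f : A⟦X⟧} (hf : constantCoeff f = 0) :
    d⁄dX A ((exp A).subst f : A⟦X⟧) = (exp A).subst f * d⁄dX A f := by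
  rw [derivative_subst (HasSubst.of_constantCoeff_zero' hf), derivative_exp]

/-- A series with vanishing derivative is constant. -/
theorem eq_C_of_derivative_eq_zero {f : A⟦X⟧} (h : d⁄dX A f = 0) : f = C (constantCoeff f) :=
  have : IsAddTorsionFree A := .of_module_rat A
  derivative.ext (by simp [h]) (by simp)

theorem exp_subst_mul_exp_subst_neg {f : A⟦X⟧} (hf : constantCoeff f = 0) :
    (exp A).subst f * (exp A).subst (-f) = (1 : A⟦X⟧) := by
  have hf' : constantCoeff (-f) = 0 := by simp [hf]
  have h := eq_C_of_derivative_eq_zero (A := A) (f := (exp A).subst f * (exp A).subst (-f)) (by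
    rw [Derivation.leibniz, derivative_exp_subst hf, derivative_exp_subst hf']
    simp only [smul_eq_mul, map_neg]
    ring)
  rw [h, map_mul, constantCoeff_exp_subst hf, constantCoeff_exp_subst hf']
  simp

/-- The derivative of `e^(f+g) e^(-f) e^(-g)` vanishes, so this product is the constant 1. -/
theorem exp_subst_add {f g : A⟦X⟧} (hf : constantCoeff f = 0) (hg : constantCoeff g = 0) :
    ((exp A).subst (f + g) : A⟦X⟧) = (exp A).subst f * (exp A).subst g := by
  have hf' : constantCoeff (-f) = 0 := by simp [hf]
  have hg' : constantCoeff (-g) = 0 := by simp [hg]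
  have hfg : constantCoeff (f + g) = 0 := by simp [hf, hg]
  have h := eq_C_of_derivative_eq_zero (A := A)
    (f := (exp A).subst (f + g) * ((exp A).subst (-f) * (exp A).subst (-g))) (by
    rw [Derivation.leibniz, Derivation.leibniz, derivative_exp_subst hfg, derivative_exp_subst hf',
      derivative_exp_subst hg']
    simp only [smul_eq_mul, map_neg, map_add]
    ring)
  rw [map_mul, map_mul constantCoeff ((exp A).subst (-f) : A⟦X⟧), constantCoeff_exp_subst hfg, constantCoeff_exp_subst hf',
    constantCoeff_exp_subst hg'] at h
  simp only [mul_one, map_one] at h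
  calc ((exp A).subst (f + g) : A⟦X⟧)
      = (exp A).subst (f + g) * (((exp A).subst f * (exp A).subst (-f)) *
          ((exp A).subst g * (exp A).subst (-g))) := by
        rw [exp_subst_mul_exp_subst_neg hf, exp_subst_mul_exp_subst_neg hg]; simp
    _ = ((exp A).subst (f + g) * ((exp A).subst (-f) * (exp A).subst (-g))) *
          ((exp A).subst f * (exp A).subst g) := by ring
    _ = _ := by rw [h, one_mul]

/-- Uniqueness for the equation `f' = c f`. -/
theorem eq_exp_subst_of_derivative {f g : A⟦X⟧} (hg : constantCoeff g = 0)
    (h : d⁄dX A f = f * d⁄dX A g) : f = C (constantCoeff f) * (exp A).subst g := by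
  have hg' : constantCoeff (-g) = 0 := by simp [hg]
  have h1 := eq_C_of_derivative_eq_zero (A := A) (f := f * (exp A).subst (-g)) (by
    rw [Derivation.leibniz, derivative_exp_subst hg', h]
    simp only [smul_eq_mul, map_neg]
    ring)
  rw [map_mul, constantCoeff_exp_subst hg', mul_one] at h1
  rw [← h1, mul_assoc, mul_comm ((exp A).subst (-g)), exp_subst_mul_exp_subst_neg hg, mul_one]

theorem exp_subst_C_mul_X (a : A) : ((exp A).subst (C a * X : A⟦X⟧) : A⟦X⟧) = rescale a (exp A) := by
  rw [rescale_eq_subst, smul_eq_C_mul]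

end Exponential

/-! ### The formal Gaussian expectation -/

theorem oddDoubleFactorial_zero : oddDoubleFactorial 0 = 1 := by
  simp [oddDoubleFactorial]

theorem oddDoubleFactorial_succ (k : ℕ) :
    oddDoubleFactorial (k + 1) = (2 * k + 1) * oddDoubleFactorial k := by
  have h : (2 * (k + 1)).factorial = (2 * k + 2) * ((2 * k + 1) * (2 * k).factorial) := by
    rw [show 2 * (k + 1) = (2 * k + 1) + 1 by ring, Nat.factorial_succ, Nat.factorial_succ]
  have h2 : ((k + 1).factorial : ℚ) = (k + 1) * k.factorial := by
    exact_mod_cast Nat.factorial_succ k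
  have hk : ((k : ℚ) + 1) ≠ 0 := by positivity
  rw [oddDoubleFactorial, oddDoubleFactorial, h, h2]
  push_cast
  field_simp
  ring

/-- The expectation of `f` for the centred normal law of variance `w`, as a series in `w`. -/
noncomputable def gauss : ℚ⟦X⟧ →ₗ[ℚ] ℚ⟦X⟧ where
  toFun f := PowerSeries.mk fun k => oddDoubleFactorial k * coeff (2 * k) f
  map_add' f g := by ext k; simp [mul_add]
  map_smul' c f := by ext k; simp; ring

theorem coeff_gauss (k : ℕ) (f : ℚ⟦X⟧) :
    coeff k (gauss f) = oddDoubleFactorial k * coeff (2 * k) f := by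
  simp [gauss]

/-- Gaussian integration by parts. -/
theorem gauss_X_mul (f : ℚ⟦X⟧) : gauss (X * f) = X * gauss (d⁄dX ℚ f) := by
  ext k
  rcases k with _ | k
  · simp [coeff_gauss]
  · rw [coeff_gauss, coeff_succ_X_mul, coeff_gauss, show 2 * (k + 1) = (2 * k + 1) + 1 by ring,
      coeff_succ_X_mul, coeff_derivative, oddDoubleFactorial_succ]
    push_cast
    ring

/-- In `(2k)!/(2^k k!) * b^(2k)/(2k)!` the factor `(2k)!` cancels. This is what turns Gaussian
expectations into counts of multigraphs. -/
theorem gauss_exp (b : ℚ) : gauss (rescale b (exp ℚ)) = rescale (b ^ 2 / 2) (exp ℚ) := by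
  ext k
  have h1 : ((2 * k).factorial : ℚ) ≠ 0 := by positivity
  have h2 : (k.factorial : ℚ) ≠ 0 := by positivity
  simp only [coeff_gauss, coeff_rescale, coeff_exp, oddDoubleFactorial, Algebra.algebraMap_self,
    RingHom.id_apply]
  rw [div_pow, pow_mul]
  field_simp

theorem derivative_rescale_exp (b : ℚ) :
    d⁄dX ℚ (rescale b (exp ℚ)) = b • rescale b (exp ℚ) := by
  rw [← exp_subst_C_mul_X, derivative_exp_subst (by simp), Derivation.leibniz]
  simp [mul_comm, smul_eq_C_mul]

/-! ### Series with series coefficients -/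

/-- `∑_p X^p f_p`. -/
noncomputable def layerSum {A : Type*} [CommRing A] (f : ℕ → A⟦X⟧) : A⟦X⟧ :=
  PowerSeries.mk fun n => coeff n (∑ p ∈ Finset.range (n + 1), X ^ p * f p)

/-- The truncation point is immaterial, since `X^p f_p` has no term of degree below `p`. -/
theorem coeff_layerSum {A : Type*} [CommRing A] (f : ℕ → A⟦X⟧) {n N : ℕ} (h : n < N) :
    coeff n (layerSum f) = coeff n (∑ p ∈ Finset.range N, X ^ p * f p) := by
  rw [layerSum, coeff_mk, map_sum, map_sum]
  refine Finset.sum_subset (Finset.range_subset_range.2 h) fun p _ hp => ?_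
  rw [coeff_X_pow_mul', if_neg]
  simpa using hp

theorem coeff_layerSum_eq_sum {A : Type*} [CommRing A] (f : ℕ → A⟦X⟧) (n : ℕ) :
    coeff n (layerSum f) = ∑ p ∈ Finset.range (n + 1), coeff (n - p) (f p) := by
  rw [layerSum, coeff_mk, map_sum]
  refine Finset.sum_congr rfl fun p hp => ?_
  rw [coeff_X_pow_mul', if_pos (by simpa [Nat.lt_succ_iff] using hp)]

theorem layerSum_mul {A : Type*} [CommRing A] (f : ℕ → A⟦X⟧) (g : A⟦X⟧) :
    layerSum f * g = layerSum fun p => f p * g := by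
  ext n
  rw [coeff_layerSum _ (Nat.lt_succ_self n)]
  simp only [← mul_assoc]
  rw [← Finset.sum_mul, coeff_mul, coeff_mul]
  refine Finset.sum_congr rfl fun ij hij => ?_
  rw [coeff_layerSum f (N := n + 1)]
  have := Finset.HasAntidiagonal.mem_antidiagonal.1 hij
  omega

theorem layerSum_C_mul_pow {A : Type*} [CommRing A] (c : ℕ → A) (h : A⟦X⟧) :
    layerSum (fun p => C (c p) * h ^ p) = (PowerSeries.mk c).subst (X * h) := by
  ext n
  rw [coeff_layerSum _ (Nat.lt_succ_self n), coeff_subst_eq_sum (by simp) _ (Nat.lt_succ_self n),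
    map_sum]
  refine Finset.sum_congr rfl fun p _ => ?_
  rw [mul_pow, mul_left_comm, coeff_C_mul, coeff_mk, smul_eq_mul]

/-! ### The Gaussian expectation of `e^(ax) exp(s(e^x-1-x))` -/

/-- `∑_q s^q/q! E[e^(bx) (-1-x)^q]`, a series in `s` over `ℚ⟦w⟧`. -/
noncomputable def gaussLinear (b : ℚ) : ℚ⟦X⟧⟦X⟧ :=
  PowerSeries.mk fun q => (1 / (q.factorial : ℚ)) • gauss (rescale b (exp ℚ) * (-1 - X) ^ q)

/-- Split one factor `-1-x` and integrate its `x` by parts; the derivative falls on `e^(bx)` and on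
the remaining power. At `q = 0` the truncated exponent `q - 1` is harmless, its term carrying the
factor `q`. -/
theorem gauss_linear_succ (b : ℚ) (q : ℕ) :
    gauss (rescale b (exp ℚ) * (-1 - X) ^ (q + 1)) =
      -(1 + C b * X) * gauss (rescale b (exp ℚ) * (-1 - X) ^ q) +
        (q : ℚ) • (X * gauss (rescale b (exp ℚ) * (-1 - X) ^ (q - 1))) := by
  have h1 : rescale b (exp ℚ) * (-1 - X : ℚ⟦X⟧) ^ (q + 1) =
      -(rescale b (exp ℚ) * (-1 - X) ^ q) - X * (rescale b (exp ℚ) * (-1 - X) ^ q) := by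
    rw [pow_succ]; ring
  have h2 : d⁄dX ℚ (rescale b (exp ℚ) * (-1 - X : ℚ⟦X⟧) ^ q) =
      b • (rescale b (exp ℚ) * (-1 - X) ^ q) -
        (q : ℚ) • (rescale b (exp ℚ) * (-1 - X) ^ (q - 1)) := by
    rw [Derivation.leibniz, derivative_pow, derivative_rescale_exp]
    have h3 : d⁄dX ℚ (-1 - X : ℚ⟦X⟧) = -1 := by
      rw [map_sub, map_neg, derivative_one, derivative_X]; ring
    rw [h3]
    simp only [smul_eq_mul, smul_eq_C_mul, map_natCast]
    ring_nf
  rw [h1, map_sub, map_neg, gauss_X_mul, h2, map_sub, map_smul, map_smul]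
  simp only [smul_eq_C_mul]
  ring

/-- The recursion in `q` in generating form: `G' = -(1+bw) G + w s G`. -/
theorem derivative_gaussLinear (b : ℚ) :
    d⁄dX ℚ⟦X⟧ (gaussLinear b) =
      gaussLinear b * d⁄dX ℚ⟦X⟧ (-(C (1 + C b * X) * X - C (C (1 / 2) * X) * X ^ 2)) := by
  have h2 : (C (C (1 / 2 : ℚ) * X : ℚ⟦X⟧) : ℚ⟦X⟧⟦X⟧) * 2 = C X := by
    rw [show (2 : ℚ⟦X⟧⟦X⟧) = C (C 2) by simp only [map_ofNat], ← map_mul,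
      mul_right_comm, ← map_mul]
    norm_num
  have h : d⁄dX ℚ⟦X⟧ (-(C (1 + C b * X) * X - C (C (1 / 2) * X) * X ^ 2) : ℚ⟦X⟧⟦X⟧) =
      -C (1 + C b * X) + C X * X := by
    simp only [map_neg, map_sub, Derivation.leibniz, derivative_pow, derivative_C, derivative_X,
      smul_eq_mul]
    rw [← h2]
    push_cast
    ring
  rw [h, mul_add, ← mul_assoc]
  ext1 q
  rw [coeff_derivative, map_add, mul_comm (gaussLinear b), mul_comm (gaussLinear b), ← map_neg,
    coeff_C_mul, gaussLinear, coeff_mk, gauss_linear_succ]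
  have hq : ((q + 1).factorial : ℚ) = (q + 1) * q.factorial := by
    exact_mod_cast Nat.factorial_succ q
  have hq0 : (q.factorial : ℚ) ≠ 0 := by positivity
  have hq1 : (q : ℚ) + 1 ≠ 0 := by positivity
  have e1 : (1 / ((q + 1).factorial : ℚ)) * (q + 1) = 1 / (q.factorial : ℚ) := by
    rw [hq]; field_simp
  have key (u : ℚ⟦X⟧) : (1 / ((q + 1).factorial : ℚ)) • u * ((q : ℚ⟦X⟧) + 1) =
      (1 / (q.factorial : ℚ)) • u := by
    rw [← e1, mul_smul, smul_mul_assoc]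
    congr 1
    rw [smul_eq_C_mul, map_add, map_natCast, map_one, mul_comm]
  rw [key]
  rcases q with _ | q
  · simp
  · rw [coeff_succ_mul_X, coeff_C_mul, coeff_mk, coeff_mk, smul_add, Nat.add_sub_cancel]
    have e2 : (1 / ((q + 1).factorial : ℚ)) * ((q + 1 : ℕ) : ℚ) = 1 / (q.factorial : ℚ) := by
      rw [Nat.factorial_succ]; push_cast; field_simp
    rw [smul_smul, e2, mul_smul_comm, mul_smul_comm]

/-- Heuristically `e^(-s) E[e^((b-s)x)] = exp(-s + w(b-s)²/2)`; formally, the solution of the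
differential equation with initial value `E[e^(bx)]`. -/
theorem gaussLinear_eq (b : ℚ) :
    gaussLinear b * (exp ℚ⟦X⟧).subst (C (1 + C b * X) * X - C (C (1 / 2) * X) * X ^ 2 : ℚ⟦X⟧⟦X⟧) =
      C (rescale (b ^ 2 / 2) (exp ℚ)) := by
  have h0 : constantCoeff (C (1 + C b * X) * X - C (C (1 / 2) * X) * X ^ 2 : ℚ⟦X⟧⟦X⟧) = 0 := by
    simp
  have h := eq_exp_subst_of_derivative (by rw [map_neg, h0, neg_zero]) (derivative_gaussLinear b)
  rw [h, mul_assoc, mul_comm (subst (-_) _), exp_subst_mul_exp_subst_neg h0, mul_one]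
  congr 1
  rw [← coeff_zero_eq_constantCoeff_apply, gaussLinear, coeff_mk]
  simp [gauss_exp]

/-- `∑_j s^j/j! E[e^(ax) (e^x-1-x)^j]`, a series in `s` over `ℚ⟦w⟧`. -/
noncomputable def gaussCore (a : ℚ) : ℚ⟦X⟧⟦X⟧ :=
  PowerSeries.mk fun j =>
    (1 / (j.factorial : ℚ)) • gauss (rescale a (exp ℚ) * (exp ℚ - 1 - X) ^ j)

/-- Binomial expansion of `(e^x + (-1-x))^j`; each `e^(px)` merges with the weight `e^(ax)`. -/
theorem gaussCore_eq_layerSum (a : ℚ) :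
    gaussCore a = layerSum fun p => C (C (1 / (p.factorial : ℚ))) * gaussLinear (p + a) := by
  ext1 n
  rw [gaussCore, coeff_mk, coeff_layerSum_eq_sum]
  have h : (exp ℚ - 1 - X : ℚ⟦X⟧) = exp ℚ + (-1 - X) := by ring
  rw [h, (Commute.all (exp ℚ) (-1 - X)).add_pow', Finset.mul_sum, map_sum, Finset.smul_sum,
    Finset.Nat.sum_antidiagonal_eq_sum_range_succ fun i j => (1 / (n.factorial : ℚ)) •
      gauss (rescale a (exp ℚ) * n.choose i • (exp ℚ ^ i * (-1 - X) ^ j))]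
  refine Finset.sum_congr rfl fun i hi => ?_
  obtain ⟨j, rfl⟩ := Nat.exists_eq_add_of_le (Nat.lt_succ_iff.1 (Finset.mem_range.1 hi))
  rw [Nat.add_sub_cancel_left]
  rw [coeff_C_mul, gaussLinear, coeff_mk, exp_pow_eq_rescale_exp, mul_smul_comm, map_nsmul,
    ← mul_assoc, exp_mul_exp_eq_exp_add, ← smul_eq_C_mul, smul_smul, ← Nat.cast_smul_eq_nsmul ℚ,
    smul_smul, add_comm a]
  congr 1
  rw [Nat.cast_choose ℚ (Nat.le_add_right i j), Nat.add_sub_cancel_left]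
  have h1 : ((i + j).factorial : ℚ) ≠ 0 := by positivity
  field_simp

/-- `∑_n e^(w(n+a)²/2) z^n/n!`. -/
noncomputable def shiftedMultigraphs (a : ℚ) : ℚ⟦X⟧⟦X⟧ :=
  PowerSeries.mk fun n => C (1 / (n.factorial : ℚ)) * rescale (((n : ℚ) + a) ^ 2 / 2) (exp ℚ)

/-- The exponent that clears layer `p` is the one for `p + a`. It exceeds the exponent for `a` by
`pws`, so layer `p` retains a factor `e^(-pws)`, which the argument `s e^(-ws)` absorbs. -/
theorem gaussCore_mul_exp (a : ℚ) :
    gaussCore a * (exp ℚ⟦X⟧).subst (C (1 + C a * X) * X - C (C (1 / 2) * X) * X ^ 2 : ℚ⟦X⟧⟦X⟧) =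
      (shiftedMultigraphs a).subst (X * (exp ℚ⟦X⟧).subst (-(C X * X) : ℚ⟦X⟧⟦X⟧) : ℚ⟦X⟧⟦X⟧) := by
  rw [gaussCore_eq_layerSum, layerSum_mul, shiftedMultigraphs, ← layerSum_C_mul_pow]
  congr 1
  funext p
  have hp : (C (1 + C a * X) * X - C (C (1 / 2) * X) * X ^ 2 : ℚ⟦X⟧⟦X⟧) =
      (C (1 + C (p + a) * X) * X - C (C (1 / 2) * X) * X ^ 2) + p • (-(C X * X)) := by
    rw [nsmul_eq_mul]
    simp only [map_add, map_mul, map_one, map_natCast]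
    ring
  have hpow : ∀ p : ℕ, (exp ℚ⟦X⟧).subst (p • (-(C X * X)) : ℚ⟦X⟧⟦X⟧) =
      ((exp ℚ⟦X⟧).subst (-(C X * X) : ℚ⟦X⟧⟦X⟧) : ℚ⟦X⟧⟦X⟧) ^ p := by
    intro p
    induction p with
    | zero =>
      rw [zero_nsmul, pow_zero, subst_zero_eq_C_constantCoeff]
      simp
    | succ p ih =>
      rw [succ_nsmul, exp_subst_add (by simp) (by simp), ih, pow_succ]
  rw [hp, exp_subst_add (by simp) (by simp), hpow, ← mul_assoc, mul_assoc (C _) (gaussLinear _),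
    gaussLinear_eq, ← map_mul]

/-! ### Binomial coefficients at negative half-integers. -/

theorem succ_mul_choose_succ (r : ℚ) (d : ℕ) :
    ((d : ℚ) + 1) * Ring.choose r (d + 1) = (r - d) * Ring.choose r d := by
  have h : (descPochhammer ℚ (d + 1)).eval r = (r - d) * (descPochhammer ℚ d).eval r := by
    rw [descPochhammer_succ_eval, mul_comm]
  have e (n : ℕ) : Ring.choose r n = (n.factorial : ℚ)⁻¹ * (descPochhammer ℚ n).eval r := by
    rw [Ring.choose_eq_smul, smul_eq_mul, ← descPochhammer_map (Int.castRingHom ℚ),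
      Polynomial.eval_map, ← Polynomial.eval₂_smulOneHom_eq_smeval]
    congr 2
    exact Subsingleton.elim _ _
  rw [e, e, h, Nat.factorial_succ]
  have : (d.factorial : ℚ) ≠ 0 := by positivity
  have : (d : ℚ) + 1 ≠ 0 := by positivity
  push_cast
  field_simp

/-- Up to sign, the binomial coefficient is `(k+1/2)(k+3/2)⋯(k+d-1/2)/d!`, whose half-integers
extend the double factorial by `d` factors. This is where the exponent `-k-1/2` comes from. -/
theorem oddDoubleFactorial_mul_choose (k d : ℕ) :
    oddDoubleFactorial k * ((-1) ^ d * Ring.choose (-((k : ℚ) + 1 / 2)) d) =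
      oddDoubleFactorial (k + d) / (2 ^ d * d.factorial) := by
  induction d with
  | zero => simp
  | succ d ih =>
    have h := succ_mul_choose_succ (-((k : ℚ) + 1 / 2)) d
    have hd : (d : ℚ) + 1 ≠ 0 := by positivity
    have hf : (d.factorial : ℚ) ≠ 0 := by positivity
    have h1 : Ring.choose (-((k : ℚ) + 1 / 2)) (d + 1) =
        (-((k : ℚ) + 1 / 2) - d) * Ring.choose (-((k : ℚ) + 1 / 2)) d / (d + 1) := by
      rw [← h]; field_simp
    have h2 : oddDoubleFactorial (k + d) = oddDoubleFactorial k *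
        ((-1) ^ d * Ring.choose (-((k : ℚ) + 1 / 2)) d) * (2 ^ d * d.factorial) := by
      rw [ih]; field_simp
    rw [h1, ← add_assoc, oddDoubleFactorial_succ, h2, Nat.factorial_succ]
    push_cast
    field_simp
    ring

/-! ### Gradings by excess -/

/-- `F(zw)`. -/
noncomputable def diag : ℚ⟦X⟧ →+* ℚ⟦X⟧⟦X⟧ :=
  (rescale (X : ℚ⟦X⟧)).comp (PowerSeries.map C)

theorem coeff_diag (F : ℚ⟦X⟧) (n : ℕ) : coeff n (diag F) = X ^ n * C (coeff n F) := by
  simp [diag]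

theorem diag_X : diag X = C X * X := by
  simp [diag, rescale_X]

theorem diag_exp_subst {F : ℚ⟦X⟧} (hF : constantCoeff F = 0) :
    diag ((exp ℚ).subst F) = (exp ℚ⟦X⟧).subst (diag F) := by
  have h0 : constantCoeff (diag F) = 0 := by
    rw [← coeff_zero_eq_constantCoeff_apply, coeff_diag]; simp [hF]
  ext1 n
  rw [coeff_diag, coeff_subst_eq_sum hF _ (Nat.lt_succ_self n),
    coeff_subst_eq_sum h0 _ (Nat.lt_succ_self n), map_sum, Finset.mul_sum]
  refine Finset.sum_congr rfl fun d _ => ?_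
  rw [← map_pow, coeff_diag]
  have : coeff d (exp ℚ⟦X⟧) = C (coeff d (exp ℚ)) := by
    rw [coeff_exp, coeff_exp]; rfl
  rw [this]
  simp only [smul_eq_mul, map_mul]
  ring

/-- `∑_k w^k A_k(zw)`: the series whose part of excess `k` is `A_k`. -/
noncomputable def assemble (A : ℕ → ℚ⟦X⟧) : ℚ⟦X⟧⟦X⟧ :=
  PowerSeries.mk fun n => PowerSeries.mk fun m => if n ≤ m then coeff n (A (m - n)) else 0

theorem excessPart_assemble (A : ℕ → ℚ⟦X⟧) (k : ℕ) : excessPart k (assemble A) = A k := by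
  ext n
  simp [excessPart, assemble]

/-- `diag G` contains only monomials of excess 0, so it multiplies each level separately. -/
theorem diag_mul_assemble (G : ℚ⟦X⟧) (A : ℕ → ℚ⟦X⟧) :
    diag G * assemble A = assemble fun k => G * A k := by
  ext n m
  rw [coeff_mul]
  simp only [assemble, coeff_mk, coeff_diag, mul_assoc, map_sum, coeff_X_pow_mul',
    coeff_C_mul]
  by_cases h : n ≤ m
  · rw [if_pos h, coeff_mul]
    refine Finset.sum_congr rfl fun ij hij => ?_
    rw [Finset.HasAntidiagonal.mem_antidiagonal] at hij
    rw [if_pos (by omega), if_pos (by omega)]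
    congr 3
    omega
  · rw [if_neg h]
    refine Finset.sum_eq_zero fun ij hij => ?_
    rw [Finset.HasAntidiagonal.mem_antidiagonal] at hij
    by_cases h1 : ij.1 ≤ m
    · rw [if_pos h1, if_neg (by omega), mul_zero]
    · rw [if_neg h1]

/-! ### The substitution `s = T(zw)/w`. -/

/-- `T(zw)/w`. -/
noncomputable def scaledTree : ℚ⟦X⟧⟦X⟧ := X * (exp ℚ⟦X⟧).subst (diag tree)

theorem constantCoeff_scaledTree : constantCoeff scaledTree = 0 := by
  simp [scaledTree]

theorem C_X_mul_scaledTree : C X * scaledTree = diag tree := by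
  conv_rhs => rw [tree_eq]
  rw [map_mul, diag_X, diag_exp_subst constantCoeff_tree, scaledTree, mul_assoc]

theorem constantCoeff_diag_tree : constantCoeff (diag tree) = 0 := by
  rw [← C_X_mul_scaledTree, map_mul, constantCoeff_scaledTree, mul_zero]

theorem hasSubst_scaledTree : HasSubst scaledTree :=
  HasSubst.of_constantCoeff_zero' constantCoeff_scaledTree

/-- So `scaledTree` inverts `s ↦ s e^(-ws)`: substituting it returns to the variable `z`. -/
theorem scaledTree_mul_exp : scaledTree * (exp ℚ⟦X⟧).subst (-(C X * scaledTree)) = X := by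
  rw [C_X_mul_scaledTree, scaledTree, mul_assoc,
    exp_subst_mul_exp_subst_neg constantCoeff_diag_tree, mul_one]

/-- `exp((T - T²/2)(zw)/w)`, the generating function of forests. -/
noncomputable def forestGF : ℚ⟦X⟧⟦X⟧ :=
  (exp ℚ⟦X⟧).subst (scaledTree - C (C (1 / 2) * X) * scaledTree ^ 2)

/-- `(2k-1)!! [x^(2k)] e^(ax) (1 - T (e^x-1-x)/(x²/2))^(-k-1/2)`. -/
noncomputable def corePart (a : ℚ) (k : ℕ) : ℚ⟦X⟧ :=
  oddDoubleFactorial k • innerCoeff (2 * k)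
    (inX (rescale a (exp ℚ)) * denomPow (-((k : ℚ) + 1 / 2)))

theorem constantCoeff_tree_mul_expQuot : constantCoeff (-(inZ tree * inX expQuot)) = 0 := by
  rw [map_neg, map_mul, ← coeff_zero_eq_constantCoeff_apply, inZ, coeff_map,
    coeff_zero_eq_constantCoeff_apply, constantCoeff_tree]
  simp

theorem coeff_denomPow (α : ℚ) (n : ℕ) :
    coeff n (denomPow α) = ∑ d ∈ Finset.range (n + 1),
      C ((-1) ^ d * Ring.choose α d * coeff n (tree ^ d)) * expQuot ^ d := by
  rw [denomPow, coeff_subst_eq_sum constantCoeff_tree_mul_expQuot _ (Nat.lt_succ_self n)]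
  refine Finset.sum_congr rfl fun d _ => ?_
  rw [binomialSeries_coeff, neg_pow, mul_pow, inZ, inX, ← map_pow, ← map_pow, ← mul_assoc,
    coeff_mul_C, show ((-1 : ℚ⟦X⟧⟦X⟧) ^ d) = C (C ((-1) ^ d)) by simp, coeff_C_mul, coeff_map,
    smul_eq_mul, mul_one, smul_eq_C_mul]
  simp only [map_mul]
  ring

theorem coeff_corePart (a : ℚ) (k n : ℕ) :
    coeff n (corePart a k) = ∑ d ∈ Finset.range (n + 1),
      oddDoubleFactorial (k + d) / (2 ^ d * d.factorial) *
        coeff (2 * k) (rescale a (exp ℚ) * expQuot ^ d) * coeff n (tree ^ d) := by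
  rw [corePart, coeff_smul, innerCoeff, coeff_mk, inX, coeff_C_mul, coeff_denomPow, Finset.mul_sum,
    map_sum, smul_eq_mul, Finset.mul_sum]
  refine Finset.sum_congr rfl fun d _ => ?_
  rw [mul_left_comm, coeff_C_mul, ← oddDoubleFactorial_mul_choose]
  ring

/-- `(e^x-1-x)^d` is `x^(2d)` times `(expQuot/2)^d`, and `x^(2(k+d))` has expectation `w^(k+d)` up
to a number; hence the factor `w^d`, after which `k` becomes the excess. -/
theorem coeff_gaussCore (a : ℚ) (d : ℕ) :
    coeff d (gaussCore a) = X ^ d * PowerSeries.mk fun k =>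
      oddDoubleFactorial (k + d) / (2 ^ d * d.factorial) *
        coeff (2 * k) (rescale a (exp ℚ) * expQuot ^ d) := by
  rw [gaussCore, coeff_mk, ← expQuot_spec]
  ext m
  have h : rescale a (exp ℚ) * ((1 / 2 : ℚ) • X ^ 2 * expQuot) ^ d =
      C ((1 / 2 : ℚ) ^ d) * (X ^ (2 * d) * (rescale a (exp ℚ) * expQuot ^ d)) := by
    rw [smul_eq_C_mul, mul_pow, mul_pow, ← pow_mul, map_pow]
    ring
  rw [coeff_smul, coeff_gauss, h, coeff_C_mul, coeff_X_pow_mul', coeff_X_pow_mul']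
  by_cases hd : d ≤ m
  · obtain ⟨k, rfl⟩ := Nat.exists_eq_add_of_le' hd
    rw [if_pos hd, if_pos (by omega), coeff_mk, Nat.add_sub_cancel,
      show 2 * (k + d) - 2 * d = 2 * k by omega]
    have : (d.factorial : ℚ) ≠ 0 := by positivity
    rw [smul_eq_mul, one_div_pow]
    field_simp
  · rw [if_neg hd, if_neg (by omega)]
    simp

/-- The `w^d` found in the coefficient of `s^d` combines with `s^d = (T(zw)/w)^d` into `T(zw)^d`,
which has excess 0. -/
theorem gaussCore_subst_scaledTree (a : ℚ) :
    (gaussCore a).subst scaledTree = assemble (corePart a) := by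
  ext n m
  rw [coeff_subst_eq_sum constantCoeff_scaledTree _ (Nat.lt_succ_self n), assemble, coeff_mk,
    coeff_mk, map_sum]
  have key (d : ℕ) : coeff d (gaussCore a) • coeff n (scaledTree ^ d) =
      X ^ n * (C (coeff n (tree ^ d)) * PowerSeries.mk fun k =>
        oddDoubleFactorial (k + d) / (2 ^ d * d.factorial) *
          coeff (2 * k) (rescale a (exp ℚ) * expQuot ^ d)) := by
    have h : X ^ d * coeff n (scaledTree ^ d) = X ^ n * C (coeff n (tree ^ d)) := by
      rw [← coeff_diag, map_pow diag, ← C_X_mul_scaledTree, mul_pow, ← map_pow, coeff_C_mul]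
    rw [coeff_gaussCore, smul_eq_mul, mul_right_comm, h]
    ring
  simp only [key, coeff_X_pow_mul', coeff_C_mul, coeff_mk]
  split_ifs with h
  · rw [coeff_corePart]
    exact Finset.sum_congr rfl fun d _ => mul_comm _ _
  · simp

/-- Multigraphs with `a` extra vertices of weight one, in terms of trees and cores. -/
theorem shiftedMultigraphs_eq (a : ℚ) :
    shiftedMultigraphs a =
      forestGF * (diag ((exp ℚ).subst (a • tree)) * assemble (corePart a)) := by
  -- Put `s = T(zw)/w` in `gaussCore_mul_exp`: `s e^(-ws)` becomes `z`, and the extra `aws` in the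
  -- exponent becomes `a T(zw)`.
  have h := congrArg (fun F : ℚ⟦X⟧⟦X⟧ => (F.subst scaledTree : ℚ⟦X⟧⟦X⟧)) (gaussCore_mul_exp a)
  have hS := hasSubst_scaledTree
  have e1 : ((C (1 + C a * X) * X - C (C (1 / 2) * X) * X ^ 2 : ℚ⟦X⟧⟦X⟧).subst scaledTree :
      ℚ⟦X⟧⟦X⟧) = (scaledTree - C (C (1 / 2) * X) * scaledTree ^ 2) + diag (a • tree) := by
    rw [subst_sub hS, subst_mul hS, subst_mul hS, subst_pow hS, subst_X hS, subst_C, subst_C]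
    change C _ * _ - C _ * _ = _
    rw [smul_eq_C_mul, map_mul diag, ← C_X_mul_scaledTree]
    have : diag (C a) = C (C a) := by
      ext1 n
      rw [coeff_diag, coeff_C, coeff_C]
      split_ifs with hn <;> simp [hn]
    rw [this]
    simp only [map_add, map_mul, map_one]
    ring
  have e2 : ((X * (exp ℚ⟦X⟧).subst (-(C X * X) : ℚ⟦X⟧⟦X⟧) : ℚ⟦X⟧⟦X⟧).subst scaledTree :
      ℚ⟦X⟧⟦X⟧) = X := by
    rw [subst_mul hS, subst_X hS,
      subst_comp_subst_apply (HasSubst.of_constantCoeff_zero' (by simp)) hS,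
      ← coe_substAlgHom hS, map_neg, map_mul, coe_substAlgHom, subst_X hS, subst_C]
    exact scaledTree_mul_exp
  rw [subst_mul hS, subst_comp_subst_apply (HasSubst.of_constantCoeff_zero' (by simp)) hS,
    subst_comp_subst_apply (HasSubst.of_constantCoeff_zero' (by simp)) hS, e1, e2, X_subst,
    gaussCore_subst_scaledTree] at h
  have h1 : constantCoeff (scaledTree - C (C (1 / 2) * X) * scaledTree ^ 2) = 0 := by
    simp [constantCoeff_scaledTree]
  have h2 : constantCoeff (a • tree) = 0 := by
    rw [smul_eq_C_mul, map_mul, constantCoeff_tree, mul_zero]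
  have h3 : constantCoeff (diag (a • tree)) = 0 := by
    rw [smul_eq_C_mul, map_mul, map_mul, constantCoeff_diag_tree, mul_zero]
  rw [← h, exp_subst_add h1 h3, diag_exp_subst h2, forestGF]
  ring

/-! ### Uniqueness of the factorization into positive and nonpositive excess -/

/-- Series all of whose monomials `zⁿ wᵐ` satisfy `m ≤ n`. -/
noncomputable def nonposExcess : Subring ℚ⟦X⟧⟦X⟧ where
  carrier := {F | ∀ n m, n < m → coeff m (coeff n F) = 0}
  zero_mem' := by simp
  one_mem' n m h := by
    rw [coeff_one]
    split_ifs
    · rw [coeff_one, if_neg (by omega)]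
    · simp
  add_mem' hF hG n m h := by simp [hF n m h, hG n m h]
  neg_mem' hF n m h := by simp [hF n m h]
  mul_mem' {F G} hF hG n m h := by
    rw [coeff_mul, map_sum]
    refine Finset.sum_eq_zero fun ij hij => ?_
    rw [coeff_mul]
    refine Finset.sum_eq_zero fun pq hpq => ?_
    rw [Finset.HasAntidiagonal.mem_antidiagonal] at hij hpq
    by_cases h1 : ij.1 < pq.1
    · rw [hF _ _ h1, zero_mul]
    · rw [hG _ _ (by omega), mul_zero]

theorem X_mem_nonposExcess : (X : ℚ⟦X⟧⟦X⟧) ∈ nonposExcess := by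
  intro n m h
  rw [coeff_X]
  split_ifs
  · rw [coeff_one, if_neg (by omega)]
  · simp

theorem C_C_mem_nonposExcess (c : ℚ) : (C (C c) : ℚ⟦X⟧⟦X⟧) ∈ nonposExcess := by
  intro n m h
  rw [coeff_C]
  split_ifs
  · rw [coeff_C, if_neg (by omega)]
  · simp

theorem diag_mem_nonposExcess (F : ℚ⟦X⟧) : diag F ∈ nonposExcess := by
  intro n m h
  rw [coeff_diag, coeff_mul_C, coeff_X_pow, if_neg (by omega), zero_mul]

theorem exp_subst_mem_nonposExcess {F : ℚ⟦X⟧⟦X⟧} (h0 : constantCoeff F = 0)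
    (hF : F ∈ nonposExcess) : ((exp ℚ⟦X⟧).subst F : ℚ⟦X⟧⟦X⟧) ∈ nonposExcess := by
  intro n m h
  rw [coeff_subst_eq_sum h0 _ (Nat.lt_succ_self n), map_sum]
  refine Finset.sum_eq_zero fun d _ => ?_
  have : coeff d (exp ℚ⟦X⟧) = C (coeff d (exp ℚ)) := by
    rw [coeff_exp, coeff_exp]; rfl
  rw [this, smul_eq_mul, coeff_C_mul, pow_mem hF d n m h, mul_zero]

theorem scaledTree_mem_nonposExcess : scaledTree ∈ nonposExcess :=
  mul_mem X_mem_nonposExcess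
    (exp_subst_mem_nonposExcess constantCoeff_diag_tree (diag_mem_nonposExcess _))

theorem constantCoeff_forest_exponent :
    constantCoeff (scaledTree - C (C (1 / 2) * X) * scaledTree ^ 2) = 0 := by
  simp [constantCoeff_scaledTree]

theorem forestGF_mem_nonposExcess : forestGF ∈ nonposExcess := by
  refine exp_subst_mem_nonposExcess constantCoeff_forest_exponent ?_
  -- The factor `w` alone has positive excess; it must be absorbed as `w s² = T(zw) s`.
  have : C (C (1 / 2) * X) * scaledTree ^ 2 = C (C (1 / 2)) * (diag tree * scaledTree) := by
    rw [← C_X_mul_scaledTree, map_mul]; ring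
  rw [this]
  exact sub_mem scaledTree_mem_nonposExcess (mul_mem (C_C_mem_nonposExcess _)
    (mul_mem (diag_mem_nonposExcess _) scaledTree_mem_nonposExcess))

theorem constantCoeff_forestGF : constantCoeff forestGF = 1 :=
  constantCoeff_exp_subst constantCoeff_forest_exponent

/-- In degree `n` in `z`, once lower degrees agree, the identity reads `(P_n - P'_n) + (N_n - N'_n)
= 0`, and the two differences have disjoint supports in `w`. -/
theorem positive_factor_unique {P N P' N' : ℚ⟦X⟧⟦X⟧} (h : P * N = P' * N')
    (hP0 : coeff 0 P = 1) (hN0 : coeff 0 N = 1) (hP0' : coeff 0 P' = 1) (hN0' : coeff 0 N' = 1)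
    (hP : ∀ n m, n ≠ 0 → m ≤ n → coeff m (coeff n P) = 0) (hN : N ∈ nonposExcess)
    (hP' : ∀ n m, n ≠ 0 → m ≤ n → coeff m (coeff n P') = 0) (hN' : N' ∈ nonposExcess) :
    P = P' := by
  suffices hs : ∀ n, coeff n P = coeff n P' ∧ coeff n N = coeff n N' from
    PowerSeries.ext fun n => (hs n).1
  intro n
  induction n using Nat.strong_induction_on with
  | _ n ih =>
    rcases Nat.eq_zero_or_pos n with rfl | hn
    · exact ⟨hP0.trans hP0'.symm, hN0.trans hN0'.symm⟩
    have h1 : ∑ ij ∈ Finset.HasAntidiagonal.antidiagonal n,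
        (coeff ij.1 P * coeff ij.2 N - coeff ij.1 P' * coeff ij.2 N') = 0 := by
      rw [Finset.sum_sub_distrib, ← coeff_mul, ← coeff_mul, h, sub_self]
    -- Only the two extreme products involve degree `n`; the induction hypothesis cancels all the
    -- others.
    rw [Finset.sum_eq_add_of_mem (0, n) (n, 0) (by simp) (by simp)
      (by simpa using fun h => absurd h.symm hn.ne')] at h1
    · dsimp only at h1
      rw [hP0, hP0', hN0, hN0'] at h1
      have h2 : ∀ m, coeff m (coeff n P) = coeff m (coeff n P') ∧
          coeff m (coeff n N) = coeff m (coeff n N') := by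
        intro m
        have h3 := congrArg (coeff m) h1
        simp only [one_mul, mul_one, map_add, map_sub, map_zero] at h3
        rcases le_or_gt m n with hm | hm
        · rw [hP n m hn.ne' hm, hP' n m hn.ne' hm] at h3 ⊢
          exact ⟨rfl, by linarith⟩
        · rw [hN n m hm, hN' n m hm] at h3 ⊢
          exact ⟨by linarith, rfl⟩
      exact ⟨PowerSeries.ext fun m => (h2 m).1, PowerSeries.ext fun m => (h2 m).2⟩
    · rintro ⟨i, j⟩ hij ⟨hc1, hc2⟩
      rw [Finset.HasAntidiagonal.mem_antidiagonal] at hij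
      dsimp only at hij ⊢
      have hi : i < n := by
        rcases Nat.lt_or_ge i n with hi | hi
        · exact hi
        · exact absurd (by ext <;> simp <;> omega) hc2
      have hj : j < n := by
        rcases Nat.lt_or_ge j n with hj | hj
        · exact hj
        · exact absurd (by ext <;> simp <;> omega) hc1
      rw [(ih i hi).1, (ih j hj).2, sub_self]

/-- Moving the level `A 0` to the nonpositive side gives `assemble (A' * A k)` times `forestGF *
diag (A 0)`. The first factor now has level 0 equal to 1, so it is admissible in the uniqueness
statement. -/
theorem positive_factor_eq {P N : ℚ⟦X⟧⟦X⟧} {A : ℕ → ℚ⟦X⟧} {A' : ℚ⟦X⟧}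
    (h : P * N = forestGF * assemble A) (hA' : A' * A 0 = 1) (hA0 : constantCoeff (A 0) = 1)
    (hA : ∀ k, k ≠ 0 → constantCoeff (A k) = 0)
    (hP0 : coeff 0 P = 1) (hN0 : coeff 0 N = 1)
    (hP : ∀ n m, n ≠ 0 → m ≤ n → coeff m (coeff n P) = 0) (hN : N ∈ nonposExcess) (k : ℕ) :
    excessPart k P = A' * A k := by
  have hA'0 : constantCoeff A' = 1 := by
    have := congrArg constantCoeff hA'
    rwa [map_mul, hA0, mul_one, map_one] at this
  rw [← excessPart_assemble (fun k => A' * A k) k]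
  congr 1
  refine positive_factor_unique (N := N) (N' := forestGF * diag (A 0)) ?_ hP0 hN0 ?_ ?_ hP hN ?_
    (mul_mem forestGF_mem_nonposExcess (diag_mem_nonposExcess _))
  · rw [h, ← diag_mul_assemble, mul_comm (diag A'), mul_mul_mul_comm, mul_comm (assemble A),
      mul_assoc, mul_comm (assemble A), mul_left_comm, ← map_mul, hA', map_one, one_mul]
  · ext m
    rw [assemble, coeff_mk, coeff_mk, if_pos (Nat.zero_le m), coeff_one, Nat.sub_zero,
      coeff_zero_eq_constantCoeff_apply, map_mul, hA'0, one_mul]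
    split_ifs with hm
    · rw [hm, hA0]
    · exact hA m hm
  · rw [coeff_zero_eq_constantCoeff_apply, map_mul, constantCoeff_forestGF, one_mul,
      ← coeff_zero_eq_constantCoeff_apply, coeff_diag, coeff_zero_eq_constantCoeff_apply, hA0]
    simp
  · intro n m hn hm
    rw [assemble, coeff_mk, coeff_mk]
    split_ifs with h1
    · obtain rfl : n = m := le_antisymm h1 hm
      rw [Nat.sub_self, hA', coeff_one, if_neg hn]
    · rfl

/-! ### Excess zero -/

theorem one_sub_tree_ne_zero : (1 - tree : ℚ⟦X⟧) ≠ 0 := by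
  intro h
  have := congrArg constantCoeff h
  simp [constantCoeff_tree] at this

theorem constantCoeff_inv_one_sub_tree : constantCoeff ((1 - tree : ℚ⟦X⟧)⁻¹) = 1 := by
  rw [constantCoeff_inv, map_sub, map_one, constantCoeff_tree, sub_zero, inv_one]

theorem constantCoeff_multiUnicycle : constantCoeff multiUnicycle = 0 := by
  rw [multiUnicycle, smul_eq_C_mul, map_mul,
    constantCoeff_logOf constantCoeff_inv_one_sub_tree, mul_zero]

theorem mul_derivative_logOf {f : ℚ⟦X⟧} (hf : constantCoeff f = 1) :
    f * d⁄dX ℚ (logOf f) = d⁄dX ℚ f := by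
  have h0 : constantCoeff (f - 1) = 0 := by rw [map_sub, hf, map_one, sub_self]
  have hs : HasSubst (f - 1) := HasSubst.of_constantCoeff_zero' h0
  have h1 : (1 + X) * d⁄dX ℚ (log ℚ) = 1 := by
    rw [deriv_log]
    ext n
    rcases n with _ | n
    · simp
    · rw [add_mul, one_mul, map_add, coeff_succ_X_mul]
      simp [coeff_one, pow_succ]
  have h2 := congrArg (fun g : ℚ⟦X⟧ => (g.subst (f - 1) : ℚ⟦X⟧)) h1
  simp only [subst_mul hs, subst_add hs, subst_X hs, ← coe_substAlgHom hs, map_one] at h2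
  rw [coe_substAlgHom hs] at h2
  rw [logOf_eq, derivative_subst hs, ← mul_assoc]
  rw [show f = 1 + (f - 1) by ring]
  rw [add_sub_cancel_left 1 (f - 1), h2]
  simp

theorem one_sub_tree_mul_derivative_multiUnicycle :
    (1 - tree) * d⁄dX ℚ multiUnicycle = (1 / 2 : ℚ) • d⁄dX ℚ tree := by
  have hc : constantCoeff (1 - tree : ℚ⟦X⟧) ≠ 0 := by simp [constantCoeff_tree]
  have h := mul_derivative_logOf constantCoeff_inv_one_sub_tree
  rw [derivative_inv'] at h
  have h1 : (1 - tree : ℚ⟦X⟧) * (1 - tree)⁻¹ = 1 := PowerSeries.mul_inv_cancel _ hc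
  have h2 : (1 - tree : ℚ⟦X⟧) * d⁄dX ℚ (logOf ((1 - tree)⁻¹)) = d⁄dX ℚ tree := by
    calc (1 - tree : ℚ⟦X⟧) * d⁄dX ℚ (logOf ((1 - tree)⁻¹))
        = (1 - tree) ^ 2 * ((1 - tree)⁻¹ * d⁄dX ℚ (logOf ((1 - tree)⁻¹))) := by
          rw [sq, mul_assoc, ← mul_assoc (1 - tree) (1 - tree)⁻¹, h1, one_mul]
      _ = -(((1 - tree) * (1 - tree)⁻¹) ^ 2 * d⁄dX ℚ (1 - tree)) := by rw [h]; ring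
      _ = d⁄dX ℚ tree := by rw [h1, map_sub, derivative_one]; ring
  rw [multiUnicycle, Derivation.map_smul, mul_smul_comm, h2]

/-- Only `[x^0]` is extracted, so `a` plays no role and the series is `(1-T)^(-1/2)`; it satisfies
the first-order equation of `e^MV`. -/
theorem corePart_zero_right (a : ℚ) : corePart a 0 = (exp ℚ).subst multiUnicycle := by
  set y : ℚ⟦X⟧ := PowerSeries.mk fun d => oddDoubleFactorial d / (2 ^ d * d.factorial) with hy
  have hT : HasSubst tree := HasSubst.of_constantCoeff_zero' constantCoeff_tree
  have e1 : corePart a 0 = y.subst tree := by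
    ext n
    rw [coeff_corePart, coeff_subst_eq_sum constantCoeff_tree _ (Nat.lt_succ_self n)]
    refine Finset.sum_congr rfl fun d _ => ?_
    have : coeff (2 * 0) (rescale a (exp ℚ) * expQuot ^ d) = 1 := by
      rw [mul_zero, coeff_zero_eq_constantCoeff_apply, map_mul, map_pow]
      simp [← coeff_zero_eq_constantCoeff_apply, coeff_rescale, expQuot]
    rw [this, hy, coeff_mk, zero_add, mul_one, smul_eq_mul]
  -- The differential equation of `(1-X)^(-1/2)`.
  have e2 : (1 - X) * d⁄dX ℚ y = (1 / 2 : ℚ) • y := by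
    have hs (d : ℕ) : coeff (d + 1) y * ((d : ℚ) + 1) = (d + 1 / 2) * coeff d y := by
      have : (d.factorial : ℚ) ≠ 0 := by positivity
      have : (d : ℚ) + 1 ≠ 0 := by positivity
      rw [hy, coeff_mk, coeff_mk, oddDoubleFactorial_succ, Nat.factorial_succ, pow_succ]
      push_cast
      field_simp
    ext d
    rw [sub_mul, one_mul, map_sub, coeff_derivative, hs, coeff_smul, smul_eq_mul]
    rcases d with _ | d
    · simp
    · rw [coeff_succ_X_mul, coeff_derivative]
      push_cast
      ring
  have e3 : d⁄dX ℚ (y.subst tree : ℚ⟦X⟧) = y.subst tree * d⁄dX ℚ multiUnicycle := by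
    refine mul_left_cancel₀ one_sub_tree_ne_zero ?_
    have h2 := congrArg (fun g : ℚ⟦X⟧ => (g.subst tree : ℚ⟦X⟧)) e2
    simp only [subst_mul hT, subst_sub hT, subst_X hT, subst_smul hT] at h2
    rw [← coe_substAlgHom hT, map_one, coe_substAlgHom hT] at h2
    rw [derivative_subst hT, ← mul_assoc, h2, mul_left_comm,
      one_sub_tree_mul_derivative_multiUnicycle, smul_mul_assoc, mul_smul_comm]
  have e4 := eq_exp_subst_of_derivative constantCoeff_multiUnicycle e3
  rw [e1, e4, constantCoeff_subst_eq constantCoeff_tree]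
  simp [hy, ← coeff_zero_eq_constantCoeff_apply, oddDoubleFactorial_zero]

theorem constantCoeff_corePart_zero (k : ℕ) :
    constantCoeff (corePart 0 k) = if k = 0 then 1 else 0 := by
  rw [← coeff_zero_eq_constantCoeff_apply, coeff_corePart]
  rcases k with _ | k
  · simp [oddDoubleFactorial_zero]
  · simp

/-- Multigraphs all of whose components have positive excess. -/
theorem multigraph_formula {P N : ℚ⟦X⟧⟦X⟧} (h : P * N = shiftedMultigraphs 0)
    (hP0 : coeff 0 P = 1) (hN0 : coeff 0 N = 1)
    (hP : ∀ n m, n ≠ 0 → m ≤ n → coeff m (coeff n P) = 0) (hN : N ∈ nonposExcess) (k : ℕ) :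
    excessPart k P = (exp ℚ).subst (-multiUnicycle) * corePart 0 k := by
  have h1 : shiftedMultigraphs 0 = forestGF * assemble (corePart 0) := by
    have h0 : ((exp ℚ).subst ((0 : ℚ) • tree) : ℚ⟦X⟧) = 1 := by
      rw [zero_smul, subst_zero_eq_C_constantCoeff]; simp
    rw [shiftedMultigraphs_eq, h0, map_one, one_mul]
  refine positive_factor_eq (h.trans h1) ?_ (by simp [constantCoeff_corePart_zero])
    (fun k hk => by simp [constantCoeff_corePart_zero, hk]) hP0 hN0 hP hN k
  rw [corePart_zero_right, mul_comm, exp_subst_mul_exp_subst_neg constantCoeff_multiUnicycle]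

/-! ### Corrections for loops and double edges -/

/-- The coefficients of `w^m` in `(1+w)^(n(n-1)/2) e^(-wn²/2)`, as polynomials in `n`. -/
noncomputable def correctionPoly : ℕ → Polynomial ℚ
  | 0 => 1
  | 1 => -(Polynomial.C (1 / 2) * Polynomial.X)
  | m + 2 => Polynomial.C (1 / ((m : ℚ) + 2)) *
      (-((Polynomial.C ((m : ℚ) + 1) + Polynomial.C (1 / 2) * Polynomial.X) *
        correctionPoly (m + 1)) - Polynomial.C (1 / 2) * Polynomial.X ^ 2 * correctionPoly m)

/-- This bound is what excludes negative excess in the patchwork series at `u = -1`. -/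
theorem natDegree_correctionPoly_le (m : ℕ) : (correctionPoly m).natDegree ≤ m := by
  induction m using Nat.twoStepInduction with
  | zero => simp [correctionPoly]
  | one => rw [correctionPoly]; compute_degree
  | more m ih0 ih1 =>
    rw [correctionPoly]
    refine (Polynomial.natDegree_C_mul_le _ _).trans ?_
    refine (Polynomial.natDegree_sub_le _ _).trans (max_le ?_ ?_)
    · rw [Polynomial.natDegree_neg]
      refine Polynomial.natDegree_mul_le.trans ?_
      have : (Polynomial.C ((m : ℚ) + 1) + Polynomial.C (1 / 2) * Polynomial.X).natDegree ≤ 1 := by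
        compute_degree
      omega
    · refine Polynomial.natDegree_mul_le.trans ?_
      have : (Polynomial.C (1 / 2 : ℚ) * Polynomial.X ^ 2).natDegree ≤ 2 := by
        compute_degree
      omega

/-- Keeping only top-degree terms, the recursion becomes the coefficient recursion of `y' =
-(1+X)y/2`. -/
theorem coeff_correctionPoly_self (m : ℕ) :
    (correctionPoly m).coeff m =
      coeff m ((exp ℚ).subst (-((1 / 2 : ℚ) • X + (1 / 4 : ℚ) • X ^ 2) : ℚ⟦X⟧) : ℚ⟦X⟧) := by
  set y : ℚ⟦X⟧ := (exp ℚ).subst (-((1 / 2 : ℚ) • X + (1 / 4 : ℚ) • X ^ 2) : ℚ⟦X⟧) with hy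
  have hc : constantCoeff (-((1 / 2 : ℚ) • X + (1 / 4 : ℚ) • X ^ 2) : ℚ⟦X⟧) = 0 := by
    simp [smul_eq_C_mul]
  have h : d⁄dX ℚ y = C (-(1 / 2)) * y + C (-(1 / 2)) * (X * y) := by
    rw [hy, derivative_exp_subst hc]
    have : d⁄dX ℚ (-((1 / 2 : ℚ) • X + (1 / 4 : ℚ) • X ^ 2) : ℚ⟦X⟧) =
        C (-(1 / 2)) + C (-(1 / 2)) * X := by
      have e : (C (1 / 4 : ℚ) : ℚ⟦X⟧) * 2 = C (1 / 2) := by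
        rw [show (2 : ℚ⟦X⟧) = C 2 by simp only [map_ofNat], ← map_mul]; norm_num
      rw [map_neg, map_add, Derivation.map_smul, Derivation.map_smul, derivative_pow, derivative_X,
        smul_eq_C_mul, smul_eq_C_mul]
      rw [map_neg, ← e]
      push_cast
      ring
    rw [this]
    ring
  have h0 : coeff 0 y = 1 := by
    rw [coeff_zero_eq_constantCoeff_apply, hy, constantCoeff_exp_subst hc]
  have hs (d : ℕ) := congrArg (coeff d) h
  simp only [coeff_derivative, map_add, coeff_C_mul] at hs
  induction m using Nat.twoStepInduction with
  | zero => simp [correctionPoly, h0]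
  | one =>
    have := hs 0
    simp only [h0, coeff_zero_X_mul, Nat.cast_zero, zero_add, mul_one, mul_zero, add_zero] at this
    rw [this, correctionPoly]
    simp
  | more m ih0 ih1 =>
    have h1 := hs (m + 1)
    rw [coeff_succ_X_mul, ← ih0, ← ih1] at h1
    have hm : (m : ℚ) + 2 ≠ 0 := by positivity
    have h2 : (correctionPoly (m + 1)).coeff (m + 2) = 0 :=
      Polynomial.coeff_eq_zero_of_natDegree_lt
        (lt_of_le_of_lt (natDegree_correctionPoly_le _) (by omega))
    rw [correctionPoly, Polynomial.coeff_C_mul, Polynomial.coeff_sub, Polynomial.coeff_neg, add_mul,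
      Polynomial.coeff_add, Polynomial.coeff_C_mul, h2, mul_assoc, mul_assoc, Polynomial.coeff_C_mul,
      Polynomial.coeff_C_mul, Polynomial.coeff_X_mul, Polynomial.coeff_X_pow_mul]
    push_cast at h1
    field_simp
    linarith

/-- The product `Q` satisfies `(1+w)Q' = -(n/2)Q - (n²/2)wQ`; reading off coefficients gives the
recursion defining `correctionPoly`. -/
theorem coeff_correction (n m : ℕ) :
    coeff m ((1 + X) ^ n.choose 2 * rescale (-((n : ℚ) ^ 2 / 2)) (exp ℚ) : ℚ⟦X⟧) =
      (correctionPoly m).eval (n : ℚ) := by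
  set Q : ℚ⟦X⟧ := (1 + X) ^ n.choose 2 * rescale (-((n : ℚ) ^ 2 / 2)) (exp ℚ) with hQ
  have hc : ((n.choose 2 : ℕ) : ℚ) = n * (n - 1) / 2 := Nat.cast_choose_two ℚ n
  have h : (1 + X) * d⁄dX ℚ Q = C (-((n : ℚ) / 2)) * Q - C ((n : ℚ) ^ 2 / 2) * (X * Q) := by
    have e1 : (1 + X) * d⁄dX ℚ ((1 + X : ℚ⟦X⟧) ^ n.choose 2) =
        C ((n : ℚ) * (n - 1) / 2) * (1 + X) ^ n.choose 2 := by
      rw [derivative_pow, map_add, derivative_one, derivative_X, ← hc, map_natCast]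
      rcases n.choose 2 with _ | c
      · simp
      · rw [Nat.add_sub_cancel, pow_succ]; ring
    have e2 : (C (-((n : ℚ) / 2)) : ℚ⟦X⟧) = C ((n : ℚ) * (n - 1) / 2) - C ((n : ℚ) ^ 2 / 2) := by
      rw [← map_sub]; congr 1; ring
    rw [hQ, Derivation.leibniz, derivative_rescale_exp, e2, smul_eq_mul, smul_eq_mul, mul_add,
      ← mul_assoc (1 + X) (rescale _ _), mul_comm (1 + X) (rescale _ _), mul_assoc (rescale _ _), e1,
      smul_eq_C_mul, map_neg]
    ring
  have h0 : coeff 0 Q = 1 := by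
    rw [coeff_zero_eq_constantCoeff_apply, hQ, map_mul, map_pow, map_add,
      ← coeff_zero_eq_constantCoeff_apply (rescale _ _), coeff_rescale]
    simp
  have hs (d : ℕ) := congrArg (coeff d) h
  simp only [add_mul, one_mul, map_add, map_sub, coeff_C_mul, coeff_derivative] at hs
  induction m using Nat.twoStepInduction with
  | zero => simp [correctionPoly, h0]
  | one =>
    have h1 := hs 0
    simp only [h0, coeff_zero_X_mul, Nat.cast_zero, zero_add, mul_one, mul_zero, add_zero,
      sub_zero] at h1
    rw [h1, correctionPoly]
    simp
    ring
  | more m ih0 ih1 =>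
    have h1 := hs (m + 1)
    rw [coeff_succ_X_mul, coeff_succ_X_mul, coeff_derivative, ih0, ih1] at h1
    have hm : (m : ℚ) + 2 ≠ 0 := by positivity
    have h2 : ((m : ℚ) + 2) * coeff (m + 2) Q = -((m : ℚ) + 1 + n / 2) *
        (correctionPoly (m + 1)).eval (n : ℚ) - n ^ 2 / 2 * (correctionPoly m).eval (n : ℚ) := by
      push_cast at h1
      linarith
    rw [correctionPoly]
    simp only [Polynomial.eval_mul, Polynomial.eval_sub, Polynomial.eval_neg, Polynomial.eval_add,
      Polynomial.eval_C, Polynomial.eval_X, Polynomial.eval_pow]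
    rw [← mul_right_inj' hm, h2]
    field_simp

/-! ### Finite differences and the correction series. -/

theorem binomial_transform_injective {f g : ℕ → ℚ}
    (h : ∀ n, ∑ a ∈ Finset.range (n + 1), (n.choose a : ℚ) * f a =
      ∑ a ∈ Finset.range (n + 1), (n.choose a : ℚ) * g a) (n : ℕ) : f n = g n := by
  induction n using Nat.strong_induction_on with
  | _ n ih =>
    have h1 := h n
    rw [Finset.sum_range_succ, Finset.sum_range_succ, Nat.choose_self, Nat.cast_one, one_mul,
      one_mul, Finset.sum_congr rfl fun a ha => by rw [ih a (Finset.mem_range.1 ha)]] at h1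
    exact add_left_cancel h1

/-- The relation between patchworks and simple graphs obtained by inclusion and exclusion. -/
def IsCorrection (W : ℚ⟦X⟧⟦X⟧) : Prop :=
  ∀ n : ℕ, C (1 / (n.factorial : ℚ)) * (1 + X) ^ n.choose 2 =
    rescale ((n : ℚ) ^ 2 / 2) (exp ℚ) *
      ∑ a ∈ Finset.range (n + 1), C (1 / ((n - a).factorial : ℚ)) * coeff a W

/-- After multiplication by `n! e^(-wn²/2)`, the relation says that the binomial transform of `a!
[w^m] W_a` takes the values of `correctionPoly m` at `n`. Newton's forward difference formula has
the same transform, and binomial transforms are injective. -/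
theorem IsCorrection.factorial_mul_coeff {W : ℚ⟦X⟧⟦X⟧} (h : IsCorrection W) (a m : ℕ) :
    (a.factorial : ℚ) * coeff m (coeff a W) =
      (fwdDiff (1 : ℚ))^[a] (fun x => (correctionPoly m).eval x) 0 := by
  refine binomial_transform_injective
    (f := fun a => (a.factorial : ℚ) * coeff m (coeff a W))
    (g := fun a => (fwdDiff (1 : ℚ))^[a] (fun x => (correctionPoly m).eval x) 0) (fun n => ?_) a
  have h1 := shift_eq_sum_fwdDiff_iter (1 : ℚ) (fun x => (correctionPoly m).eval x) n 0
  rw [zero_add, nsmul_eq_mul, mul_one, ← coeff_correction] at h1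
  simp only [nsmul_eq_mul] at h1
  rw [← h1]
  have hn : (n.factorial : ℚ) ≠ 0 := by positivity
  have e1 : (1 + X) ^ n.choose 2 = C (n.factorial : ℚ) *
      (C (1 / (n.factorial : ℚ)) * (1 + X : ℚ⟦X⟧) ^ n.choose 2) := by
    rw [← mul_assoc, ← map_mul, mul_one_div_cancel hn, map_one, one_mul]
  have e2 : rescale ((n : ℚ) ^ 2 / 2) (exp ℚ) * rescale (-((n : ℚ) ^ 2 / 2)) (exp ℚ) = 1 := by
    rw [exp_mul_exp_eq_exp_add, add_neg_cancel]; simp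
  rw [e1, h n, mul_assoc, mul_right_comm, e2, one_mul, Finset.mul_sum, map_sum]
  refine Finset.sum_congr rfl fun b hb => ?_
  rw [coeff_C_mul, coeff_C_mul, ← mul_assoc, ← mul_assoc]
  congr 1
  rw [Nat.cast_choose ℚ (Nat.lt_succ_iff.1 (Finset.mem_range.1 hb))]
  have : (b.factorial : ℚ) ≠ 0 := by positivity
  field_simp

/-- The `a`-th difference of a polynomial of degree at most `m < a` is zero. -/
theorem IsCorrection.coeff_eq_zero {W : ℚ⟦X⟧⟦X⟧} (h : IsCorrection W) {a m : ℕ} (hm : m < a) :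
    coeff m (coeff a W) = 0 := by
  have h1 := h.factorial_mul_coeff a m
  rw [Polynomial.fwdDiff_iter_eq_zero_of_degree_lt
    (lt_of_le_of_lt (natDegree_correctionPoly_le m) hm), Pi.zero_apply] at h1
  exact (mul_eq_zero.1 h1).resolve_left (by positivity)

/-- The `m`-th difference of a polynomial of degree at most `m` is `m!` times its coefficient of
degree `m`. -/
theorem IsCorrection.excessPart_zero {W : ℚ⟦X⟧⟦X⟧} (h : IsCorrection W) :
    excessPart 0 W = (exp ℚ).subst (-((1 / 2 : ℚ) • X + (1 / 4 : ℚ) • X ^ 2) : ℚ⟦X⟧) := by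
  ext m
  rw [excessPart, coeff_mk, add_zero, ← coeff_correctionPoly_self]
  have h1 := h.factorial_mul_coeff m m
  have hm : (m.factorial : ℚ) ≠ 0 := by positivity
  rw [← mul_right_inj' hm, h1]
  rcases (natDegree_correctionPoly_le m).lt_or_eq with h2 | h2
  · rw [Polynomial.fwdDiff_iter_eq_zero_of_degree_lt h2, Polynomial.coeff_eq_zero_of_natDegree_lt h2]
    simp
  · have h3 := Polynomial.fwdDiff_iter_degree_eq_factorial (correctionPoly m)
    rw [h2, Polynomial.leadingCoeff, h2] at h3
    rw [h3]
    simp [mul_comm]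

theorem IsCorrection.coeff_zero {W : ℚ⟦X⟧⟦X⟧} (h : IsCorrection W) : coeff 0 W = 1 := by
  simpa using (h 0).symm

/-! ### Simple graphs -/

theorem innerCoeff_inZ_mul (j : ℕ) (f : ℚ⟦X⟧) (G : ℚ⟦X⟧⟦X⟧) :
    innerCoeff j (inZ f * G) = f * innerCoeff j G := by
  ext n
  simp only [innerCoeff, coeff_mk, coeff_mul, map_sum, inZ, coeff_map]
  refine Finset.sum_congr rfl fun ij _ => ?_
  rw [← coeff_mul, coeff_C_mul]

/-- `(2j-1)!! [x^(2j)] p(T e^x) (1 - T (e^x-1-x)/(x²/2))^(-j-1/2)`. -/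
noncomputable def weightedCore (p : ℚ⟦X⟧) (j : ℕ) : ℚ⟦X⟧ :=
  oddDoubleFactorial j • innerCoeff (2 * j)
    (p.subst (inZ tree * inX (exp ℚ)) * denomPow (-((j : ℚ) + 1 / 2)))

theorem constantCoeff_inZ_tree_mul (f : ℚ⟦X⟧) : constantCoeff (inZ tree * inX f) = 0 := by
  rw [map_mul, ← coeff_zero_eq_constantCoeff_apply, inZ, coeff_map,
    coeff_zero_eq_constantCoeff_apply, constantCoeff_tree, map_zero, zero_mul]

/-- Expand `p(T e^x)`: the term of degree `a` contributes `T^a` and the weight `e^(ax)`, which is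
the parameter of `corePart`. -/
theorem coeff_weightedCore (p : ℚ⟦X⟧) (j n : ℕ) :
    coeff n (weightedCore p j) =
      ∑ a ∈ Finset.range (n + 1), coeff a p * coeff n (tree ^ a * corePart a j) := by
  have h1 : coeff n (p.subst (inZ tree * inX (exp ℚ)) * denomPow (-((j : ℚ) + 1 / 2))) =
      ∑ a ∈ Finset.range (n + 1), C (coeff a p) *
        coeff n (inZ (tree ^ a) * (inX (rescale (a : ℚ) (exp ℚ)) *
          denomPow (-((j : ℚ) + 1 / 2)))) := by
    have e (a : ℕ) : (inZ tree * inX (exp ℚ)) ^ a =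
        inZ (tree ^ a) * inX (rescale (a : ℚ) (exp ℚ)) := by
      rw [mul_pow, ← exp_pow_eq_rescale_exp]
      simp [inZ, inX]
    simp only [← mul_assoc, ← e]
    rw [coeff_mul]
    simp only [coeff_mul _ (_ ^ _), Finset.mul_sum]
    rw [Finset.sum_comm]
    refine Finset.sum_congr rfl fun rs hrs => ?_
    rw [Finset.HasAntidiagonal.mem_antidiagonal] at hrs
    rw [coeff_subst_eq_sum (constantCoeff_inZ_tree_mul _) _ (N := n + 1) (by omega),
      Finset.sum_mul]
    refine Finset.sum_congr rfl fun a _ => ?_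
    rw [smul_eq_C_mul, mul_assoc]
  rw [weightedCore, coeff_smul, innerCoeff, coeff_mk, h1, map_sum, smul_eq_mul, Finset.mul_sum]
  refine Finset.sum_congr rfl fun a _ => ?_
  rw [coeff_C_mul, corePart, mul_smul_comm, ← innerCoeff_inZ_mul, coeff_smul, innerCoeff, coeff_mk,
    smul_eq_mul]
  ring

/-- The generating function of the graphs of excess `k` without tree component. -/
noncomputable def graphCore (W : ℚ⟦X⟧⟦X⟧) (k : ℕ) : ℚ⟦X⟧ :=
  ∑ l ∈ Finset.range (k + 1), weightedCore (excessPart l W) (k - l)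

theorem IsCorrection.eq_X_pow_mul {W : ℚ⟦X⟧⟦X⟧} (h : IsCorrection W) (a : ℕ) :
    coeff a W = X ^ a * PowerSeries.mk fun l => coeff a (excessPart l W) := by
  ext m
  rw [coeff_X_pow_mul']
  split_ifs with ham
  · rw [coeff_mk, excessPart, coeff_mk, Nat.add_sub_cancel' ham]
  · exact h.coeff_eq_zero (not_le.1 ham)

theorem C_mul_assemble (p : ℚ⟦X⟧) (A : ℕ → ℚ⟦X⟧) :
    C p * assemble A =
      assemble fun k => ∑ l ∈ Finset.range (k + 1), C (coeff l p) * A (k - l) := by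
  ext n m
  rw [coeff_C_mul, assemble, coeff_mk, assemble, coeff_mk, coeff_mk]
  have e : (PowerSeries.mk fun m => if n ≤ m then coeff n (A (m - n)) else 0) =
      X ^ n * PowerSeries.mk fun k => coeff n (A k) := by
    ext m
    rw [coeff_X_pow_mul', coeff_mk]
    split_ifs <;> simp
  rw [e, mul_left_comm, coeff_X_pow_mul', map_sum]
  split_ifs
  · rw [coeff_mul, Finset.Nat.sum_antidiagonal_eq_sum_range_succ fun i j =>
      coeff i p * coeff j (PowerSeries.mk fun k => coeff n (A k))]
    simp only [coeff_mk, coeff_C_mul]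
  · rfl

/-- `shiftedMultigraphs_eq` gives every layer the same factor `forestGF`. In what remains, the
weight `e^(aT(zw))`, the `z^a` of the layer and the `w^a` dividing `W_a` combine into `T(zw)^a`. -/
theorem IsCorrection.layerSum_eq {W : ℚ⟦X⟧⟦X⟧} (h : IsCorrection W) :
    layerSum (fun a => C (coeff a W) * shiftedMultigraphs a) =
      forestGF * assemble (graphCore W) := by
  have e1 : (fun a : ℕ => C (coeff a W) * shiftedMultigraphs a) = fun a : ℕ =>
      C (coeff a W) * (diag ((exp ℚ).subst ((a : ℚ) • tree)) * assemble (corePart a)) * forestGF := by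
    funext a
    rw [shiftedMultigraphs_eq]
    ring
  rw [e1, ← layerSum_mul, mul_comm]
  congr 1
  have e2 (a : ℕ) : X ^ a * (C (coeff a W) *
      (diag ((exp ℚ).subst ((a : ℚ) • tree)) * assemble (corePart a))) =
      assemble fun k => ∑ l ∈ Finset.range (k + 1),
        C (coeff a (excessPart l W)) * (tree ^ a * corePart a (k - l)) := by
    have hpow : ((exp ℚ).subst ((a : ℚ) • tree) : ℚ⟦X⟧) = (exp ℚ).subst tree ^ a := by
      induction a with
      | zero =>
        rw [Nat.cast_zero, zero_smul, pow_zero, subst_zero_eq_C_constantCoeff]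
        simp
      | succ a ih =>
        have h0 : constantCoeff ((a : ℚ) • tree) = 0 := by
          rw [smul_eq_C_mul, map_mul, constantCoeff_tree, mul_zero]
        rw [Nat.cast_succ, add_smul, one_smul, exp_subst_add h0 constantCoeff_tree, ih, pow_succ]
    -- `(zw)^a e^(aT(zw)) = T(zw)^a`, by the equation of `T`.
    have hd : X ^ a * C X ^ a * diag ((exp ℚ).subst ((a : ℚ) • tree)) = diag (tree ^ a) := by
      conv_rhs => rw [tree_eq]
      rw [hpow, mul_pow, map_mul diag, map_pow diag X, diag_X, mul_pow]
      ring
    rw [h.eq_X_pow_mul a, map_mul C, map_pow C]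
    set p : ℚ⟦X⟧ := PowerSeries.mk fun l => coeff a (excessPart l W) with hp
    calc X ^ a * (C X ^ a * C p *
          (diag ((exp ℚ).subst ((a : ℚ) • tree)) * assemble (corePart a)))
        = C p * ((X ^ a * C X ^ a * diag ((exp ℚ).subst ((a : ℚ) • tree))) *
            assemble (corePart a)) := by ring
      _ = _ := by
        rw [hd, diag_mul_assemble, C_mul_assemble]
        simp only [hp, coeff_mk]
  ext n m
  rw [coeff_layerSum _ (Nat.lt_succ_self n), map_sum, map_sum]
  simp only [e2]
  simp only [assemble, coeff_mk]
  split_ifs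
  · simp only [map_sum, graphCore, coeff_C_mul, coeff_weightedCore]
    exact Finset.sum_comm
  · simp

/-- `e^(wn²/2)/(n-a)!` is the coefficient of `z^(n-a)` in `shiftedMultigraphs a`: free edges see all
`n` vertices, of which `a` are already used by the patchwork. -/
theorem IsCorrection.simpleGraphs_eq {W : ℚ⟦X⟧⟦X⟧} (h : IsCorrection W) :
    (PowerSeries.mk fun n : ℕ => C (1 / (n.factorial : ℚ)) * (1 + X) ^ n.choose 2) =
      forestGF * assemble (graphCore W) := by
  rw [← h.layerSum_eq]
  ext1 n
  rw [coeff_mk, h n, coeff_layerSum_eq_sum, Finset.mul_sum]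
  refine Finset.sum_congr rfl fun a ha => ?_
  have ha := Nat.lt_succ_iff.1 (Finset.mem_range.1 ha)
  rw [coeff_C_mul, shiftedMultigraphs, coeff_mk, Nat.cast_sub ha, sub_add_cancel]
  ring

theorem IsCorrection.constantCoeff_graphCore {W : ℚ⟦X⟧⟦X⟧} (h : IsCorrection W) (k : ℕ) :
    constantCoeff (graphCore W k) = if k = 0 then 1 else 0 := by
  rw [graphCore, map_sum, Finset.sum_eq_single_of_mem 0 (by simp)]
  · rw [← coeff_zero_eq_constantCoeff_apply, coeff_weightedCore]
    simp [excessPart, h.coeff_zero, constantCoeff_corePart_zero]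
  · intro l _ hl
    rw [← coeff_zero_eq_constantCoeff_apply, coeff_weightedCore]
    simp [excessPart, h.coeff_zero, coeff_one, hl]

/-- At excess 0 only `W_0(T)` times `e^MV` remains, and `W_0(T) = e^(-T/2-T²/4)` is exactly the
difference between `MV` and `V`. -/
theorem IsCorrection.graphCore_zero {W : ℚ⟦X⟧⟦X⟧} (h : IsCorrection W) :
    graphCore W 0 = (exp ℚ).subst unicycle := by
  have hT : HasSubst tree := HasSubst.of_constantCoeff_zero' constantCoeff_tree
  have h1 : graphCore W 0 =
      (excessPart 0 W).subst tree * (exp ℚ).subst multiUnicycle := by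
    ext n
    rw [graphCore, zero_add, Finset.sum_range_one, coeff_weightedCore, coeff_mul]
    simp only [Nat.sub_zero, corePart_zero_right, coeff_mul, Finset.mul_sum]
    rw [Finset.sum_comm]
    refine Finset.sum_congr rfl fun rs hrs => ?_
    rw [Finset.HasAntidiagonal.mem_antidiagonal] at hrs
    rw [coeff_subst_eq_sum constantCoeff_tree _ (N := n + 1) (by omega), Finset.sum_mul]
    refine Finset.sum_congr rfl fun a _ => ?_
    rw [smul_eq_mul, mul_assoc]
  have hc : constantCoeff (-((1 / 2 : ℚ) • X + (1 / 4 : ℚ) • X ^ 2) : ℚ⟦X⟧) = 0 := by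
    simp [smul_eq_C_mul]
  have e1 : ((-((1 / 2 : ℚ) • X + (1 / 4 : ℚ) • X ^ 2) : ℚ⟦X⟧).subst tree : ℚ⟦X⟧) =
      -((1 / 2 : ℚ) • tree + (1 / 4 : ℚ) • tree ^ 2) := by
    rw [← coe_substAlgHom hT, map_neg, map_add, map_smul, map_smul, map_pow, coe_substAlgHom,
      subst_X hT]
  have hc' : constantCoeff (-((1 / 2 : ℚ) • tree + (1 / 4 : ℚ) • tree ^ 2) : ℚ⟦X⟧) = 0 := by
    simp [smul_eq_C_mul, constantCoeff_tree]
  rw [h1, h.excessPart_zero, subst_comp_subst_apply (HasSubst.of_constantCoeff_zero' hc) hT, e1,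
    ← exp_subst_add hc' constantCoeff_multiUnicycle, unicycle]
  congr 1
  ring

theorem constantCoeff_unicycle : constantCoeff unicycle = 0 := by
  simp [unicycle, smul_eq_C_mul, constantCoeff_tree, constantCoeff_multiUnicycle]

/-- Graphs all of whose components have positive excess. -/
theorem IsCorrection.graph_formula {W P N : ℚ⟦X⟧⟦X⟧} (hW : IsCorrection W)
    (h : P * N = PowerSeries.mk fun n : ℕ => C (1 / (n.factorial : ℚ)) * (1 + X) ^ n.choose 2)
    (hP0 : coeff 0 P = 1) (hN0 : coeff 0 N = 1)
    (hP : ∀ n m, n ≠ 0 → m ≤ n → coeff m (coeff n P) = 0) (hN : N ∈ nonposExcess) (k : ℕ) :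
    excessPart k P = (exp ℚ).subst (-unicycle) * graphCore W k := by
  refine positive_factor_eq (h.trans hW.simpleGraphs_eq) ?_
    (by simp [hW.constantCoeff_graphCore])
    (fun k hk => by simp [hW.constantCoeff_graphCore, hk]) hP0 hN0 hP hN k
  rw [hW.graphCore_zero, mul_comm, exp_subst_mul_exp_subst_neg constantCoeff_unicycle]

end ExcessGF

namespace ExcessGF
namespace Multigraph

variable {V E V' E' : Type*}

/-! ### Components of multigraphs -/

theorem excess_induce (G : Multigraph V E) (S : Set V) :
    (G.induce S).excess = ({e | (G e).1 ∈ S ∧ (G e).2 ∈ S}.ncard : ℤ) - S.ncard := rfl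

theorem support_adj {G : Multigraph V E} {u v : V} :
    G.support.Adj u v ↔ u ≠ v ∧ ((∃ e, G e = (u, v)) ∨ ∃ e, G e = (v, u)) := Iff.rfl

theorem reachable_ends (G : Multigraph V E) (e : E) : G.support.Reachable (G e).1 (G e).2 := by
  by_cases h : (G e).1 = (G e).2
  · rw [h]
  · exact SimpleGraph.Adj.reachable (support_adj.2 ⟨h, Or.inl ⟨e, rfl⟩⟩)

/-- The excess of the component of a vertex. -/
noncomputable def vertexExcess (G : Multigraph V E) (v : V) : ℤ :=
  (G.induce {u | G.support.Reachable u v}).excess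

theorem vertexExcess_eq_excess_supp (G : Multigraph V E) (v : V) :
    G.vertexExcess v = (G.induce (G.support.connectedComponentMk v).supp).excess := by
  have h : (G.support.connectedComponentMk v).supp = {u | G.support.Reachable u v} := by
    ext u
    exact SimpleGraph.ConnectedComponent.eq
  rw [vertexExcess, h]

theorem pos_iff_vertexExcess {G : Multigraph V E} : G.Pos ↔ ∀ v, 0 < G.vertexExcess v := by
  constructor
  · intro hG v
    rw [vertexExcess_eq_excess_supp]
    exact hG _
  · intro hG c
    induction c using SimpleGraph.ConnectedComponent.ind with
    | _ v =>
      rw [← vertexExcess_eq_excess_supp]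
      exact hG v

/-- `G'` is a union of components of `G`, through the maps `f` and `g`. -/
structure IsClosedSub (G' : Multigraph V' E') (G : Multigraph V E) (f : V' → V) (g : E' → E) :
    Prop where
  injective_vertex : Function.Injective f
  injective_edge : Function.Injective g
  map_edge : ∀ e, G (g e) = (f (G' e).1, f (G' e).2)
  mem_range : ∀ e, (G e).1 ∈ Set.range f ∨ (G e).2 ∈ Set.range f → e ∈ Set.range g

theorem IsClosedSub.adj_iff {G' : Multigraph V' E'} {G : Multigraph V E} {f : V' → V} {g : E' → E}
    (h : IsClosedSub G' G f g) {u : V'} {w : V} :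
    G.support.Adj (f u) w ↔ ∃ v, f v = w ∧ G'.support.Adj u v := by
  constructor
  · intro hw
    rw [support_adj] at hw
    obtain ⟨hne, ⟨e, he⟩ | ⟨e, he⟩⟩ := hw
    · obtain ⟨e', rfl⟩ := h.mem_range e (Or.inl ⟨u, by rw [he]⟩)
      rw [h.map_edge, Prod.mk.injEq] at he
      refine ⟨(G' e').2, he.2, support_adj.2 ⟨?_, Or.inl ⟨e', ?_⟩⟩⟩
      · rintro rfl
        exact hne he.2
      · rw [← h.injective_vertex he.1]
    · obtain ⟨e', rfl⟩ := h.mem_range e (Or.inr ⟨u, by rw [he]⟩)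
      rw [h.map_edge, Prod.mk.injEq] at he
      refine ⟨(G' e').1, he.1, support_adj.2 ⟨?_, Or.inr ⟨e', ?_⟩⟩⟩
      · rintro rfl
        exact hne he.1
      · rw [← h.injective_vertex he.2]
  · rintro ⟨v, rfl, hv⟩
    rw [support_adj] at hv ⊢
    refine ⟨fun hf => hv.1 (h.injective_vertex hf), hv.2.imp ?_ ?_⟩
    · rintro ⟨e, he⟩
      exact ⟨g e, by rw [h.map_edge, he]⟩
    · rintro ⟨e, he⟩
      exact ⟨g e, by rw [h.map_edge, he]⟩

theorem IsClosedSub.reachable_iff {G' : Multigraph V' E'} {G : Multigraph V E} {f : V' → V}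
    {g : E' → E} (h : IsClosedSub G' G f g) {u : V'} {w : V} :
    G.support.Reachable (f u) w ↔ ∃ v, f v = w ∧ G'.support.Reachable u v := by
  constructor
  · intro hw
    rw [SimpleGraph.reachable_iff_reflTransGen] at hw
    induction hw with
    | refl => exact ⟨u, rfl, SimpleGraph.Reachable.refl u⟩
    | tail _ hadj ih =>
      obtain ⟨v, rfl, hv⟩ := ih
      obtain ⟨v', rfl, hv'⟩ := h.adj_iff.1 hadj
      exact ⟨v', rfl, hv.trans hv'.reachable⟩
  · rintro ⟨v, rfl, hv⟩
    rw [SimpleGraph.reachable_iff_reflTransGen] at hv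
    induction hv with
    | refl => exact SimpleGraph.Reachable.refl _
    | tail _ hadj ih => exact ih.trans (h.adj_iff.2 ⟨_, rfl, hadj⟩).reachable

/-- No edge leaves the image of a closed part, so components inside it, with their edges, are the
same in both multigraphs. -/
theorem IsClosedSub.vertexExcess_eq {G' : Multigraph V' E'} {G : Multigraph V E} {f : V' → V}
    {g : E' → E} (h : IsClosedSub G' G f g) (v : V') :
    G.vertexExcess (f v) = G'.vertexExcess v := by
  have h1 : {u | G.support.Reachable u (f v)} = f '' {u | G'.support.Reachable u v} := by
    ext u
    constructor
    · intro hu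
      obtain ⟨w, hw, hv⟩ := h.reachable_iff.1 (SimpleGraph.Reachable.symm hu)
      exact ⟨w, hv.symm, hw⟩
    · rintro ⟨w, hw, rfl⟩
      exact h.reachable_iff.2 ⟨v, rfl, hw⟩
  have h2 : {e | (G e).1 ∈ f '' {u | G'.support.Reachable u v} ∧
      (G e).2 ∈ f '' {u | G'.support.Reachable u v}} =
      g '' {e | (G' e).1 ∈ {u | G'.support.Reachable u v} ∧
        (G' e).2 ∈ {u | G'.support.Reachable u v}} := by
    ext e
    constructor
    · rintro ⟨he1, he2⟩
      obtain ⟨e', rfl⟩ := h.mem_range e (Or.inl (Set.image_subset_range _ _ he1))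
      rw [h.map_edge] at he1 he2
      rw [h.injective_vertex.mem_set_image] at he1 he2
      exact ⟨e', ⟨he1, he2⟩, rfl⟩
    · rintro ⟨e', ⟨he1, he2⟩, rfl⟩
      rw [Set.mem_ofPred_eq, h.map_edge]
      exact ⟨Set.mem_image_of_mem f he1, Set.mem_image_of_mem f he2⟩
  rw [vertexExcess, vertexExcess, h1, excess_induce, excess_induce, h2,
    Set.ncard_image_of_injective _ h.injective_edge,
    Set.ncard_image_of_injective _ h.injective_vertex]

/-- Vertices and edges are partitioned by components, the two ends of an edge lying in the same one.
-/
theorem excess_eq_sum [Fintype V] [Fintype E] (G : Multigraph V E)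
    [Fintype G.support.ConnectedComponent] :
    G.excess = ∑ c : G.support.ConnectedComponent, (G.induce c.supp).excess := by
  classical
  have hV : Fintype.card V = ∑ c : G.support.ConnectedComponent, c.supp.ncard := by
    rw [← Finset.card_univ, Finset.card_eq_sum_card_fiberwise
      (f := G.support.connectedComponentMk) (t := Finset.univ) (by simp)]
    refine Finset.sum_congr rfl fun c _ => ?_
    rw [← Set.ncard_coe_finset]
    congr 1
    ext v
    simp
  have hE : Fintype.card E = ∑ c : G.support.ConnectedComponent,
      {e | (G e).1 ∈ c.supp ∧ (G e).2 ∈ c.supp}.ncard := by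
    rw [← Finset.card_univ, Finset.card_eq_sum_card_fiberwise
      (f := fun e => G.support.connectedComponentMk (G e).1) (t := Finset.univ) (by simp)]
    refine Finset.sum_congr rfl fun c _ => ?_
    rw [← Set.ncard_coe_finset]
    congr 1
    ext e
    have := SimpleGraph.ConnectedComponent.eq.2 (G.reachable_ends e)
    simp [← this]
  simp only [excess_induce]
  rw [excess, Nat.card_eq_fintype_card, Nat.card_eq_fintype_card, hV, hE, Finset.sum_sub_distrib]
  push_cast
  rfl

theorem excess_pos [Finite V] [Finite E] [Nonempty V] {G : Multigraph V E} (h : G.Pos) :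
    0 < G.excess := by
  have := Fintype.ofFinite V
  have := Fintype.ofFinite E
  have := Fintype.ofFinite G.support.ConnectedComponent
  rw [excess_eq_sum]
  exact Finset.sum_pos (fun c _ => h c)
    ⟨G.support.connectedComponentMk (Classical.arbitrary V), Finset.mem_univ _⟩

/-- No component has positive excess. -/
def Nonpos (G : Multigraph V E) : Prop := ∀ v, G.vertexExcess v ≤ 0

theorem excess_nonpos [Finite V] [Finite E] {G : Multigraph V E} (h : G.Nonpos) :
    G.excess ≤ 0 := by
  have := Fintype.ofFinite V
  have := Fintype.ofFinite E
  have := Fintype.ofFinite G.support.ConnectedComponent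
  rw [excess_eq_sum]
  refine Finset.sum_nonpos fun c _ => ?_
  induction c using SimpleGraph.ConnectedComponent.ind with
  | _ v =>
    rw [← vertexExcess_eq_excess_supp]
    exact h v

/-! ### Splitting off the components of positive excess -/

section Glue

variable [DecidableEq E] {A : Finset V} {B : Finset E}

/-- The disjoint union of a multigraph on `A`, `B` and one on the complements. -/
def glue (G₁ : Multigraph {v // v ∈ A} {e // e ∈ B}) (G₂ : Multigraph {v // v ∉ A} {e // e ∉ B}) :
    Multigraph V E :=
  fun e => if h : e ∈ B then Prod.map Subtype.val Subtype.val (G₁ ⟨e, h⟩)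
    else Prod.map Subtype.val Subtype.val (G₂ ⟨e, h⟩)

theorem glue_of_mem (G₁ : Multigraph {v // v ∈ A} {e // e ∈ B})
    (G₂ : Multigraph {v // v ∉ A} {e // e ∉ B}) (e : {e // e ∈ B}) :
    glue G₁ G₂ e = ((G₁ e).1.1, (G₁ e).2.1) := by
  rw [glue, dif_pos e.2]; rfl

theorem glue_of_notMem (G₁ : Multigraph {v // v ∈ A} {e // e ∈ B})
    (G₂ : Multigraph {v // v ∉ A} {e // e ∉ B}) (e : {e // e ∉ B}) :
    glue G₁ G₂ e = ((G₂ e).1.1, (G₂ e).2.1) := by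
  rw [glue, dif_neg e.2]; rfl

theorem isClosedSub_glue_left (G₁ : Multigraph {v // v ∈ A} {e // e ∈ B})
    (G₂ : Multigraph {v // v ∉ A} {e // e ∉ B}) :
    IsClosedSub G₁ (glue G₁ G₂) Subtype.val Subtype.val where
  injective_vertex := Subtype.val_injective
  injective_edge := Subtype.val_injective
  map_edge := glue_of_mem G₁ G₂
  mem_range e he := by
    by_contra hB
    have hB : e ∉ B := fun h => hB ⟨⟨e, h⟩, rfl⟩
    have h1 := glue_of_notMem G₁ G₂ ⟨e, hB⟩
    dsimp only at h1
    rw [h1] at he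
    rcases he with ⟨x, hx⟩ | ⟨x, hx⟩ <;> dsimp only at hx
    · exact (G₂ ⟨e, hB⟩).1.2 (hx ▸ x.2)
    · exact (G₂ ⟨e, hB⟩).2.2 (hx ▸ x.2)

theorem isClosedSub_glue_right (G₁ : Multigraph {v // v ∈ A} {e // e ∈ B})
    (G₂ : Multigraph {v // v ∉ A} {e // e ∉ B}) :
    IsClosedSub G₂ (glue G₁ G₂) Subtype.val Subtype.val where
  injective_vertex := Subtype.val_injective
  injective_edge := Subtype.val_injective
  map_edge := glue_of_notMem G₁ G₂
  mem_range e he := by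
    by_contra hB
    have hB : e ∈ B := by
      by_contra h
      exact hB ⟨⟨e, h⟩, rfl⟩
    have h1 := glue_of_mem G₁ G₂ ⟨e, hB⟩
    dsimp only at h1
    rw [h1] at he
    rcases he with ⟨x, hx⟩ | ⟨x, hx⟩ <;> dsimp only at hx
    · exact x.2 (hx ▸ (G₁ ⟨e, hB⟩).1.2)
    · exact x.2 (hx ▸ (G₁ ⟨e, hB⟩).2.2)

theorem glue_injective : Function.Injective fun p : Multigraph {v // v ∈ A} {e // e ∈ B} ×
    Multigraph {v // v ∉ A} {e // e ∉ B} => glue p.1 p.2 := by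
  rintro ⟨G₁, G₂⟩ ⟨G₁', G₂'⟩ h
  dsimp only at h
  refine Prod.ext (funext fun e => ?_) (funext fun e => ?_)
  · have h1 := congrFun h e
    rw [glue_of_mem, glue_of_mem, Prod.mk.injEq] at h1
    exact Prod.ext (Subtype.ext h1.1) (Subtype.ext h1.2)
  · have h1 := congrFun h e
    rw [glue_of_notMem, glue_of_notMem, Prod.mk.injEq] at h1
    exact Prod.ext (Subtype.ext h1.1) (Subtype.ext h1.2)

theorem exists_eq_glue {G : Multigraph V E} (h₁ : ∀ e ∈ B, (G e).1 ∈ A ∧ (G e).2 ∈ A)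
    (h₂ : ∀ e ∉ B, (G e).1 ∉ A ∧ (G e).2 ∉ A) :
    ∃ (G₁ : Multigraph {v // v ∈ A} {e // e ∈ B}) (G₂ : Multigraph {v // v ∉ A} {e // e ∉ B}),
      glue G₁ G₂ = G := by
  refine ⟨fun e => (⟨_, (h₁ e e.2).1⟩, ⟨_, (h₁ e e.2).2⟩),
    fun e => (⟨_, (h₂ e e.2).1⟩, ⟨_, (h₂ e e.2).2⟩), funext fun e => ?_⟩
  rw [glue]
  split_ifs <;> rfl

end Glue

/-! ### Classes stable under relabelling and gluing. -/

/-- A multigraph without loops and multiple edges. -/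
def Simple (G : Multigraph V E) : Prop :=
  (∀ e, (G e).1 ≠ (G e).2) ∧ Function.Injective fun e => s((G e).1, (G e).2)

/-- Relabelling of vertices and edges. -/
def relabel {V' E' : Type*} (α : V' ≃ V) (β : E' ≃ E) : Multigraph V' E' ≃ Multigraph V E :=
  β.arrowCongr (α.prodCongr α)

theorem relabel_apply {V' E' : Type*} (α : V' ≃ V) (β : E' ≃ E) (G : Multigraph V' E') (e : E') :
    relabel α β G (β e) = (α (G e).1, α (G e).2) := by
  simp [relabel, Equiv.arrowCongr, Prod.map]

/-- A class of multigraphs stable under relabelling and under disjoint unions and parts of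
them. -/
structure IsAdditive (𝒮 : ∀ V E : Type, Set (Multigraph V E)) : Prop where
  relabel : ∀ {V' E' V E : Type} (α : V' ≃ V) (β : E' ≃ E) (G : Multigraph V' E'),
    relabel α β G ∈ 𝒮 V E ↔ G ∈ 𝒮 V' E'
  glue : ∀ {V E : Type} [DecidableEq E] {A : Finset V} {B : Finset E}
    (G₁ : Multigraph {v // v ∈ A} {e // e ∈ B}) (G₂ : Multigraph {v // v ∉ A} {e // e ∉ B}),
    glue G₁ G₂ ∈ 𝒮 V E ↔ G₁ ∈ 𝒮 _ _ ∧ G₂ ∈ 𝒮 _ _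
  empty : ∀ {V E : Type} [IsEmpty V] [IsEmpty E] (G : Multigraph V E), G ∈ 𝒮 V E

theorem isAdditive_univ : IsAdditive fun _ _ => Set.univ :=
  ⟨by simp, by simp, by simp⟩

theorem Simple.of_map {V' E' : Type*} {G' : Multigraph V' E'} {G : Multigraph V E} {f : V' → V}
    {g : E' → E} (hg : Function.Injective g)
    (h : ∀ e, G (g e) = (f (G' e).1, f (G' e).2)) (hG : G.Simple) : G'.Simple := by
  refine ⟨fun e he => hG.1 (g e) ?_, fun e e' he => hg (hG.2 ?_)⟩
  · rw [h, he]
  · dsimp only at he ⊢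
    rw [h, h]
    exact congrArg (Sym2.map f) he

theorem isAdditive_simple : IsAdditive fun _ _ => {G | G.Simple} where
  relabel α β G := by
    refine ⟨fun h => h.of_map β.injective (relabel_apply α β G), fun h => ?_⟩
    refine h.of_map (f := α.symm) β.symm.injective fun e => ?_
    obtain ⟨e, rfl⟩ := β.surjective e
    rw [relabel_apply]
    simp
  glue {V E _ A B} G₁ G₂ := by
    refine ⟨fun h => ⟨h.of_map Subtype.val_injective (glue_of_mem G₁ G₂),
      h.of_map Subtype.val_injective (glue_of_notMem G₁ G₂)⟩, fun ⟨h₁, h₂⟩ => ⟨fun e => ?_, ?_⟩⟩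
    · by_cases h : e ∈ B
      · have := glue_of_mem G₁ G₂ ⟨e, h⟩
        dsimp only at this
        rw [this]
        exact fun he => h₁.1 ⟨e, h⟩ (Subtype.ext he)
      · have := glue_of_notMem G₁ G₂ ⟨e, h⟩
        dsimp only at this
        rw [this]
        exact fun he => h₂.1 ⟨e, h⟩ (Subtype.ext he)
    · intro e e' he
      dsimp only at he
      by_cases h : e ∈ B <;> by_cases h' : e' ∈ B
      · have e1 := glue_of_mem G₁ G₂ ⟨e, h⟩
        have e2 := glue_of_mem G₁ G₂ ⟨e', h'⟩
        dsimp only at e1 e2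
        rw [e1, e2] at he
        have := h₁.2 (a₁ := ⟨e, h⟩) (a₂ := ⟨e', h'⟩) (Sym2.map.injective Subtype.val_injective he)
        exact congrArg Subtype.val this
      · have e1 := glue_of_mem G₁ G₂ ⟨e, h⟩
        have e2 := glue_of_notMem G₁ G₂ ⟨e', h'⟩
        dsimp only at e1 e2
        rw [e1, e2, Sym2.eq_iff] at he
        rcases he with ⟨he, -⟩ | ⟨he, -⟩ <;> dsimp only at he
        · exact absurd (he ▸ (G₁ ⟨e, h⟩).1.2) (G₂ ⟨e', h'⟩).1.2
        · exact absurd (he ▸ (G₁ ⟨e, h⟩).1.2) (G₂ ⟨e', h'⟩).2.2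
      · have e1 := glue_of_notMem G₁ G₂ ⟨e, h⟩
        have e2 := glue_of_mem G₁ G₂ ⟨e', h'⟩
        dsimp only at e1 e2
        rw [e1, e2, Sym2.eq_iff] at he
        rcases he with ⟨he, -⟩ | ⟨he, -⟩ <;> dsimp only at he
        · exact absurd (he ▸ (G₁ ⟨e', h'⟩).1.2) (G₂ ⟨e, h⟩).1.2
        · exact absurd (he ▸ (G₁ ⟨e', h'⟩).2.2) (G₂ ⟨e, h⟩).1.2
      · have e1 := glue_of_notMem G₁ G₂ ⟨e, h⟩
        have e2 := glue_of_notMem G₁ G₂ ⟨e', h'⟩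
        dsimp only at e1 e2
        rw [e1, e2] at he
        have := h₂.2 (a₁ := ⟨e, h⟩) (a₂ := ⟨e', h'⟩) (Sym2.map.injective Subtype.val_injective he)
        exact congrArg Subtype.val this
  empty G := ⟨fun e => isEmptyElim e, fun e => isEmptyElim e⟩

theorem isClosedSub_relabel {V' E' : Type*} (α : V' ≃ V) (β : E' ≃ E) (G : Multigraph V' E') :
    IsClosedSub G (relabel α β G) α β :=
  ⟨α.injective, β.injective, relabel_apply α β G, fun e _ => β.surjective e⟩

theorem pos_relabel {V' E' : Type*} (α : V' ≃ V) (β : E' ≃ E) (G : Multigraph V' E') :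
    (relabel α β G).Pos ↔ G.Pos := by
  rw [pos_iff_vertexExcess, pos_iff_vertexExcess, ← α.forall_congr_right]
  simp only [(isClosedSub_relabel α β G).vertexExcess_eq]

theorem nonpos_relabel {V' E' : Type*} (α : V' ≃ V) (β : E' ≃ E) (G : Multigraph V' E') :
    (relabel α β G).Nonpos ↔ G.Nonpos := by
  rw [Nonpos, Nonpos, ← α.forall_congr_right]
  simp only [(isClosedSub_relabel α β G).vertexExcess_eq]

theorem ncard_relabel {V' E' V E : Type} {𝓕 : ∀ V E : Type, Set (Multigraph V E)}
    (h : ∀ {V' E' V E : Type} (α : V' ≃ V) (β : E' ≃ E) (G : Multigraph V' E'),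
      relabel α β G ∈ 𝓕 V E ↔ G ∈ 𝓕 V' E') (α : V' ≃ V) (β : E' ≃ E) :
    (𝓕 V' E').ncard = (𝓕 V E).ncard :=
  Nat.card_congr ((relabel α β).subtypeEquiv fun G => (h α β G).symm)

theorem vertexExcess_ends (G : Multigraph V E) (e : E) :
    G.vertexExcess (G e).1 = G.vertexExcess (G e).2 := by
  rw [vertexExcess_eq_excess_supp, vertexExcess_eq_excess_supp,
    SimpleGraph.ConnectedComponent.eq.2 (G.reachable_ends e)]

/-- Sort the multigraphs by the set `A` of vertices and the set `B` of edges lying in components of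
positive excess. Gluing is a bijection from pairs (positive on `A`, `B`; nonpositive on the
complements) onto each class. -/
theorem ncard_eq_sum_split {𝒮 : ∀ V E : Type, Set (Multigraph V E)} (h𝒮 : IsAdditive 𝒮)
    {V E : Type} [Fintype V] [Fintype E] [DecidableEq V] [DecidableEq E] :
    (𝒮 V E).ncard = ∑ A : Finset V, ∑ B : Finset E,
      {G : Multigraph {v // v ∈ A} {e // e ∈ B} | G ∈ 𝒮 _ _ ∧ G.Pos}.ncard *
      {G : Multigraph {v // v ∉ A} {e // e ∉ B} | G ∈ 𝒮 _ _ ∧ G.Nonpos}.ncard := by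
  classical
  have h1 : (𝒮 V E).ncard = (Finset.univ.filter fun G : Multigraph V E => G ∈ 𝒮 V E).card := by
    rw [← Set.ncard_coe_finset]
    congr 1
    ext G
    simp
  rw [h1, Finset.card_eq_sum_card_fiberwise (t := Finset.univ)
    (f := fun G : Multigraph V E => ((Finset.univ.filter fun v => 0 < G.vertexExcess v),
      (Finset.univ.filter fun e => 0 < G.vertexExcess (G e).1))) (by simp), Fintype.sum_prod_type]
  refine Finset.sum_congr rfl fun A _ => Finset.sum_congr rfl fun B _ => ?_
  rw [← Set.ncard_prod, ← Set.ncard_image_of_injective _ glue_injective, ← Set.ncard_coe_finset]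
  congr 1
  ext G
  simp only [Finset.coe_filter, Finset.mem_filter, Finset.mem_univ, true_and, Set.mem_image,
    Prod.mk.injEq, Set.mem_prod, Prod.exists, Set.mem_ofPred_eq]
  constructor
  · rintro ⟨hG, rfl, rfl⟩
    obtain ⟨G₁, G₂, h⟩ := exists_eq_glue (G := G)
      (A := Finset.univ.filter fun v => 0 < G.vertexExcess v)
      (B := Finset.univ.filter fun e => 0 < G.vertexExcess (G e).1)
      (by simp only [Finset.mem_filter, Finset.mem_univ, true_and, ← G.vertexExcess_ends, and_self,
            imp_self, implies_true])
      (by simp only [Finset.mem_filter, Finset.mem_univ, true_and, ← G.vertexExcess_ends, and_self,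
            imp_self, implies_true])
    have hS := (h𝒮.glue G₁ G₂).1 (h.symm ▸ hG)
    refine ⟨G₁, G₂, ⟨⟨hS.1, pos_iff_vertexExcess.2 fun v => ?_⟩, ⟨hS.2, fun v => ?_⟩⟩, h⟩
    · rw [← (isClosedSub_glue_left G₁ G₂).vertexExcess_eq, h]
      exact (Finset.mem_filter.1 v.2).2
    · rw [← (isClosedSub_glue_right G₁ G₂).vertexExcess_eq, h]
      simpa using v.2
  · rintro ⟨G₁, G₂, ⟨⟨hS₁, hG₁⟩, ⟨hS₂, hG₂⟩⟩, rfl⟩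
    have hv (v : V) : 0 < (glue G₁ G₂).vertexExcess v ↔ v ∈ A := by
      by_cases h : v ∈ A
      · have := (isClosedSub_glue_left G₁ G₂).vertexExcess_eq ⟨v, h⟩
        dsimp only at this
        rw [this]
        simpa [h] using pos_iff_vertexExcess.1 hG₁ ⟨v, h⟩
      · have := (isClosedSub_glue_right G₁ G₂).vertexExcess_eq ⟨v, h⟩
        dsimp only at this
        rw [this]
        simpa [h] using hG₂ ⟨v, h⟩
    refine ⟨(h𝒮.glue G₁ G₂).2 ⟨hS₁, hS₂⟩, ?_, ?_⟩
    · ext v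
      simp [hv]
    · ext e
      simp only [Finset.mem_filter, Finset.mem_univ, true_and, hv]
      by_cases h : e ∈ B
      · have := glue_of_mem G₁ G₂ ⟨e, h⟩
        dsimp only at this
        rw [this]
        simp [h]
      · have := glue_of_notMem G₁ G₂ ⟨e, h⟩
        dsimp only at this
        rw [this]
        simpa [h] using (G₂ ⟨e, h⟩).1.2

theorem ncard_fin_eq_sum_split {𝒮 : ∀ V E : Type, Set (Multigraph V E)} (h𝒮 : IsAdditive 𝒮)
    (n m : ℕ) :
    (𝒮 (Fin n) (Fin m)).ncard = ∑ a ∈ Finset.range (n + 1), ∑ b ∈ Finset.range (m + 1),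
      n.choose a * m.choose b *
        ({G : Multigraph (Fin a) (Fin b) | G ∈ 𝒮 _ _ ∧ G.Pos}.ncard *
          {G : Multigraph (Fin (n - a)) (Fin (m - b)) | G ∈ 𝒮 _ _ ∧ G.Nonpos}.ncard) := by
  rw [ncard_eq_sum_split h𝒮]
  have h1 (A : Finset (Fin n)) (B : Finset (Fin m)) :
      {G : Multigraph {v // v ∈ A} {e // e ∈ B} | G ∈ 𝒮 _ _ ∧ G.Pos}.ncard *
        {G : Multigraph {v // v ∉ A} {e // e ∉ B} | G ∈ 𝒮 _ _ ∧ G.Nonpos}.ncard =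
      {G : Multigraph (Fin A.card) (Fin B.card) | G ∈ 𝒮 _ _ ∧ G.Pos}.ncard *
        {G : Multigraph (Fin (n - A.card)) (Fin (m - B.card)) |
          G ∈ 𝒮 _ _ ∧ G.Nonpos}.ncard := by
    have e1 : Fintype.card {v // v ∉ A} = n - A.card := by
      rw [Fintype.card_subtype_compl, Fintype.card_coe, Fintype.card_fin]
    have e2 : Fintype.card {e // e ∉ B} = m - B.card := by
      rw [Fintype.card_subtype_compl, Fintype.card_coe, Fintype.card_fin]
    congr 1
    · exact ncard_relabel (𝓕 := fun V E => {G | G ∈ 𝒮 V E ∧ G.Pos})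
        (fun α β G => and_congr (h𝒮.relabel α β G) (pos_relabel α β G))
        (Fintype.equivFinOfCardEq (Fintype.card_coe A))
        (Fintype.equivFinOfCardEq (Fintype.card_coe B))
    · exact ncard_relabel (𝓕 := fun V E => {G | G ∈ 𝒮 V E ∧ G.Nonpos})
        (fun α β G => and_congr (h𝒮.relabel α β G) (nonpos_relabel α β G))
        (Fintype.equivFinOfCardEq e1) (Fintype.equivFinOfCardEq e2)
  simp only [h1]
  have h2 (F : ℕ → ℕ) (N : ℕ) : ∑ A : Finset (Fin N), F A.card =
      ∑ a ∈ Finset.range (N + 1), N.choose a * F a := by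
    rw [← Finset.powerset_univ, Finset.sum_powerset_apply_card, Finset.card_univ, Fintype.card_fin]
    simp
  have h3 (A : Finset (Fin n)) := h2 (fun b =>
    {G : Multigraph (Fin A.card) (Fin b) | G ∈ 𝒮 _ _ ∧ G.Pos}.ncard *
        {G : Multigraph (Fin (n - A.card)) (Fin (m - b)) | G ∈ 𝒮 _ _ ∧ G.Nonpos}.ncard) m
  simp only [h3]
  rw [h2 (fun a => ∑ b ∈ Finset.range (m + 1), m.choose b *
    ({G : Multigraph (Fin a) (Fin b) | G ∈ 𝒮 _ _ ∧ G.Pos}.ncard *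
        {G : Multigraph (Fin (n - a)) (Fin (m - b)) | G ∈ 𝒮 _ _ ∧ G.Nonpos}.ncard))]
  simp only [Finset.mul_sum, mul_assoc]

end Multigraph
end ExcessGF

namespace ExcessGF
open PowerSeries

/-! ### Generating functions of multigraphs -/

/-- The generating function with weights `1 / (2^m m! n!)`. -/
noncomputable def countGF (c : ℕ → ℕ → ℚ) : ℚ⟦X⟧⟦X⟧ :=
  PowerSeries.mk fun n => PowerSeries.mk fun m =>
    c n m / (2 ^ m * (m.factorial : ℚ) * (n.factorial : ℚ))

theorem coeff_countGF (c : ℕ → ℕ → ℚ) (n m : ℕ) :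
    coeff m (coeff n (countGF c)) = c n m / (2 ^ m * (m.factorial : ℚ) * (n.factorial : ℚ)) := by
  rw [countGF, coeff_mk, coeff_mk]

/-- The weights are exponential in vertices and in edges and `2^m` is multiplicative, so the double
binomial convolution is a product. -/
theorem countGF_mul {c p q : ℕ → ℕ → ℚ}
    (h : ∀ n m, c n m = ∑ a ∈ Finset.range (n + 1), ∑ b ∈ Finset.range (m + 1),
      (n.choose a : ℚ) * m.choose b * (p a b * q (n - a) (m - b))) :
    countGF p * countGF q = countGF c := by
  ext n m
  rw [coeff_mul, map_sum, coeff_countGF, h, Finset.sum_div,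
    Finset.Nat.sum_antidiagonal_eq_sum_range_succ fun i j =>
      coeff m (coeff i (countGF p) * coeff j (countGF q))]
  refine Finset.sum_congr rfl fun a ha => ?_
  rw [coeff_mul, Finset.sum_div, Finset.Nat.sum_antidiagonal_eq_sum_range_succ fun i j =>
      coeff i (coeff a (countGF p)) * coeff j (coeff (n - a) (countGF q))]
  refine Finset.sum_congr rfl fun b hb => ?_
  have ha := Nat.lt_succ_iff.1 (Finset.mem_range.1 ha)
  obtain ⟨b', rfl⟩ := Nat.exists_eq_add_of_le (Nat.lt_succ_iff.1 (Finset.mem_range.1 hb))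
  rw [coeff_countGF, coeff_countGF, Nat.cast_choose ℚ ha, Nat.cast_choose ℚ (Nat.le_add_right b b'),
    Nat.add_sub_cancel_left]
  have h1 : (n.factorial : ℚ) ≠ 0 := by positivity
  have h2 : ((b + b').factorial : ℚ) ≠ 0 := by positivity
  rw [pow_add]
  field_simp

namespace Multigraph

theorem multigraphGF_split {𝒮 : ∀ V E : Type, Set (Multigraph V E)} (h𝒮 : IsAdditive 𝒮) :
    multigraphGF (fun n m => {G | G ∈ 𝒮 (Fin n) (Fin m) ∧ G.Pos}) *
      multigraphGF (fun n m => {G | G ∈ 𝒮 (Fin n) (Fin m) ∧ G.Nonpos}) =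
      countGF fun n m => ((𝒮 (Fin n) (Fin m)).ncard : ℚ) := by
  refine countGF_mul fun n m => ?_
  rw [ncard_fin_eq_sum_split h𝒮 n m]
  push_cast
  rfl

theorem coeff_zero_multigraphGF {𝓕 : ∀ n m : ℕ, Set (Multigraph (Fin n) (Fin m))}
    (h : ∀ G, G ∈ 𝓕 0 0) : coeff 0 (multigraphGF 𝓕) = 1 := by
  ext m
  rw [multigraphGF, coeff_mk, coeff_mk, coeff_one]
  rcases m with _ | m
  · rw [Set.eq_univ_of_forall h, Set.ncard_univ, Nat.card_eq_fintype_card]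
    simp
  · have : 𝓕 0 (m + 1) = ∅ := Set.eq_empty_of_forall_notMem fun G _ => isEmptyElim (G 0)
    rw [this]
    simp

theorem coeff_multigraphGF_of_pos {𝓕 : ∀ n m : ℕ, Set (Multigraph (Fin n) (Fin m))}
    (h : ∀ n m, ∀ G ∈ 𝓕 n m, G.Pos) (n m : ℕ) (hn : n ≠ 0) (hm : m ≤ n) :
    coeff m (coeff n (multigraphGF 𝓕)) = 0 := by
  have : 𝓕 n m = ∅ := by
    refine Set.eq_empty_of_forall_notMem fun G hG => ?_
    have : Nonempty (Fin n) := ⟨⟨0, Nat.pos_of_ne_zero hn⟩⟩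
    have h1 := excess_pos (h n m G hG)
    rw [excess, Nat.card_fin, Nat.card_fin] at h1
    omega
  rw [multigraphGF, coeff_mk, coeff_mk, this]
  simp

theorem multigraphGF_mem_nonposExcess {𝓕 : ∀ n m : ℕ, Set (Multigraph (Fin n) (Fin m))}
    (h : ∀ n m, ∀ G ∈ 𝓕 n m, G.Nonpos) : multigraphGF 𝓕 ∈ nonposExcess := by
  intro n m hnm
  have : 𝓕 n m = ∅ := by
    refine Set.eq_empty_of_forall_notMem fun G hG => ?_
    have h1 := excess_nonpos (h n m G hG)
    rw [excess, Nat.card_fin, Nat.card_fin] at h1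
    omega
  rw [multigraphGF, coeff_mk, coeff_mk, this]
  simp

theorem pos_of_isEmpty {V E : Type*} [IsEmpty V] (G : Multigraph V E) : G.Pos :=
  pos_iff_vertexExcess.2 fun v => isEmptyElim v

theorem nonpos_of_isEmpty {V E : Type*} [IsEmpty V] (G : Multigraph V E) : G.Nonpos :=
  fun v => isEmptyElim v

/-- `n^(2m)/(2^m m!)` is the coefficient of `w^m` in `e^(wn²/2)`. -/
theorem countGF_univ : (countGF fun n m =>
    ((Set.univ : Set (Multigraph (Fin n) (Fin m))).ncard : ℚ)) = shiftedMultigraphs 0 := by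
  ext n m
  rw [coeff_countGF, shiftedMultigraphs, coeff_mk, coeff_C_mul, coeff_rescale, coeff_exp,
    Set.ncard_univ, Nat.card_eq_fintype_card]
  simp only [Multigraph, Fintype.card_fun, Fintype.card_prod, Fintype.card_fin]
  simp only [Algebra.algebraMap_self, RingHom.id_apply, add_zero, div_pow]
  push_cast
  have : (m.factorial : ℚ) ≠ 0 := by positivity
  have : (n.factorial : ℚ) ≠ 0 := by positivity
  rw [← sq]
  field_simp

end Multigraph

/-! ### The positive factors in closed form. -/

theorem mgPos_eq (k : ℕ) : mgPos k = (exp ℚ).subst (-multiUnicycle) * corePart 0 k := by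
  have h := Multigraph.multigraphGF_split Multigraph.isAdditive_univ
  rw [Multigraph.countGF_univ] at h
  simp only [Set.mem_univ, true_and] at h
  exact multigraph_formula h
    (Multigraph.coeff_zero_multigraphGF fun G => Multigraph.pos_of_isEmpty G)
    (Multigraph.coeff_zero_multigraphGF fun G => Multigraph.nonpos_of_isEmpty G)
    (Multigraph.coeff_multigraphGF_of_pos fun _ _ _ hG => hG)
    (Multigraph.multigraphGF_mem_nonposExcess fun _ _ _ hG => hG) k

theorem coeff_one_add_X_pow (c m : ℕ) : coeff m ((1 + X : ℚ⟦X⟧) ^ c) = (c.choose m : ℚ) := by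
  have e : ((1 + X : ℚ⟦X⟧) ^ c) = (((1 + Polynomial.X) ^ c : Polynomial ℚ) : ℚ⟦X⟧) := by
    push_cast; rfl
  rw [e, Polynomial.coeff_coe, Polynomial.coeff_one_add_X_pow]

/-- The generating function of simple multigraphs of positive excess, from a correction. -/
theorem excessPart_simple_eq {W : ℚ⟦X⟧⟦X⟧} (hW : IsCorrection W)
    (hcount : ∀ n m, ({G : Multigraph (Fin n) (Fin m) | G.Simple}.ncard : ℚ) =
      2 ^ m * m.factorial * (n.choose 2).choose m) (k : ℕ) :
    excessPart k (multigraphGF fun _ _ => {G | G.Simple ∧ G.Pos}) =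
      (exp ℚ).subst (-unicycle) * graphCore W k := by
  have h := Multigraph.multigraphGF_split Multigraph.isAdditive_simple
  have h1 : (countGF fun n m => ({G : Multigraph (Fin n) (Fin m) | G.Simple}.ncard : ℚ)) =
      PowerSeries.mk fun n : ℕ => C (1 / (n.factorial : ℚ)) * (1 + X) ^ n.choose 2 := by
    ext n m
    rw [coeff_countGF, hcount, coeff_mk, coeff_C_mul, coeff_one_add_X_pow]
    have : (m.factorial : ℚ) ≠ 0 := by positivity
    field_simp
  rw [h1] at h
  exact hW.graph_formula h
    (Multigraph.coeff_zero_multigraphGF fun G =>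
      ⟨Multigraph.isAdditive_simple.empty G, Multigraph.pos_of_isEmpty G⟩)
    (Multigraph.coeff_zero_multigraphGF fun G =>
      ⟨Multigraph.isAdditive_simple.empty G, Multigraph.nonpos_of_isEmpty G⟩)
    (Multigraph.coeff_multigraphGF_of_pos fun _ _ _ hG => hG.2)
    (Multigraph.multigraphGF_mem_nonposExcess fun _ _ _ hG => hG.2) k

end ExcessGF

namespace ExcessGF
namespace Multigraph

variable {V E : Type*}

/-! ### Simple multigraphs and graphs -/

theorem edgeSet_support {G : Multigraph V E} (h : G.Simple) :
    G.support.edgeSet = Set.range fun e => s((G e).1, (G e).2) := by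
  ext z
  induction z using Sym2.ind with
  | _ u v =>
    rw [SimpleGraph.mem_edgeSet, support_adj]
    constructor
    · rintro ⟨-, ⟨e, he⟩ | ⟨e, he⟩⟩
      · exact ⟨e, by simp [he]⟩
      · exact ⟨e, by simp [he]⟩
    · rintro ⟨e, he⟩
      dsimp only at he
      have hne := h.1 e
      rcases Sym2.eq_iff.1 he with ⟨h1, h2⟩ | ⟨h1, h2⟩
      · exact ⟨h1 ▸ h2 ▸ hne, Or.inl ⟨e, Prod.ext h1 h2⟩⟩
      · exact ⟨h1 ▸ h2 ▸ hne.symm, Or.inr ⟨e, Prod.ext h1 h2⟩⟩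

theorem ncard_edgeSet_induce (H : SimpleGraph V) (S : Set V) :
    (H.induce S).edgeSet.ncard = {z | z ∈ H.edgeSet ∧ ∀ v ∈ z, v ∈ S}.ncard := by
  rw [← Set.ncard_image_of_injective _ (Sym2.map.injective Subtype.val_injective)]
  congr 1
  ext z
  constructor
  · rintro ⟨z, hz, rfl⟩
    induction z using Sym2.ind with
    | _ u v =>
      refine ⟨hz, ?_⟩
      simp
  · induction z using Sym2.ind with
    | _ u v =>
      rintro ⟨hz, hS⟩
      exact ⟨s(⟨u, hS u (by simp)⟩, ⟨v, hS v (by simp)⟩), hz, rfl⟩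

/-- In the absence of loops and multiple edges, the edges of a component biject with those of the
underlying graph. -/
theorem graphPos_support_iff {G : Multigraph V E} (h : G.Simple) :
    GraphPos G.support ↔ G.Pos := by
  refine forall_congr' fun c => ?_
  have h1 : graphExcess c.toSimpleGraph = (G.induce c.supp).excess := by
    rw [graphExcess, excess_induce]
    congr 2
    rw [SimpleGraph.ConnectedComponent.toSimpleGraph, ncard_edgeSet_induce, edgeSet_support h,
      ← Set.ncard_image_of_injective {e | (G e).1 ∈ c.supp ∧ (G e).2 ∈ c.supp} h.2]
    congr 1
    ext z
    constructor
    · rintro ⟨⟨e, rfl⟩, hz⟩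
      exact ⟨e, ⟨hz _ (by simp), hz _ (by simp)⟩, rfl⟩
    · rintro ⟨e, ⟨he1, he2⟩, rfl⟩
      exact ⟨⟨e, rfl⟩, by simpa using ⟨he1, he2⟩⟩
  rw [h1]

theorem ncard_sym2_fiber {z : Sym2 V} (hz : ¬z.IsDiag) :
    Nat.card {p : V × V // s(p.1, p.2) = z} = 2 := by
  induction z using Sym2.ind with
  | _ u v =>
    have hne : u ≠ v := by simpa using hz
    have : {p : V × V | s(p.1, p.2) = s(u, v)} = {(u, v), (v, u)} := by
      ext ⟨a, b⟩
      simp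
    change Set.ncard {p : V × V | s(p.1, p.2) = s(u, v)} = 2
    rw [this, Set.ncard_pair]
    simp [hne]

/-- The simple multigraphs with given underlying graph: labellings and orientations of its
edges. -/
theorem ncard_simple_support_eq {V : Type*} [Fintype V] {m : ℕ} {H : SimpleGraph V}
    (hH : H.edgeSet.ncard = m) :
    {G : Multigraph V (Fin m) | G.Simple ∧ G.support = H}.ncard = 2 ^ m * m.factorial := by
  classical
  -- A simple multigraph over `H` is a numbering `σ` of the edges together with one of two
  -- orientations of each.
  let Φ : (Σ σ : Fin m ≃ H.edgeSet, ∀ e, {p : V × V // s(p.1, p.2) = (σ e : Sym2 V)}) →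
      {G : Multigraph V (Fin m) | G.Simple ∧ G.support = H} := fun x =>
    ⟨fun e => (x.2 e).1, by
      have hs : Simple (fun e => (x.2 e).1 : Multigraph V (Fin m)) := by
        refine ⟨fun e he => ?_, fun e e' he => ?_⟩
        · have h1 := (x.1 e).2
          rw [← (x.2 e).2] at h1
          exact H.ne_of_adj h1 he
        · dsimp only at he
          rw [(x.2 e).2, (x.2 e').2] at he
          exact x.1.injective (Subtype.ext he)
      refine ⟨hs, SimpleGraph.edgeSet_inj.1 ?_⟩
      rw [edgeSet_support hs]
      ext z
      constructor
      · rintro ⟨e, rfl⟩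
        dsimp only
        rw [(x.2 e).2]
        exact (x.1 e).2
      · intro hz
        obtain ⟨e, he⟩ := x.1.surjective ⟨z, hz⟩
        refine ⟨e, ?_⟩
        dsimp only
        rw [(x.2 e).2, he]⟩
  have hΦ : Function.Bijective Φ := by
    constructor
    · rintro ⟨σ, q⟩ ⟨σ', q'⟩ h
      have hq (e : Fin m) : (q e).1 = (q' e).1 := congrFun (congrArg Subtype.val h) e
      obtain rfl : σ = σ' := by
        ext1 e
        exact Subtype.ext (by rw [← (q e).2, ← (q' e).2, hq e])
      congr 1
      funext e
      exact Subtype.ext (hq e)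
    · rintro ⟨G, hG, rfl⟩
      have hr := edgeSet_support hG
      let f : Fin m → G.support.edgeSet := fun e => ⟨s((G e).1, (G e).2), hr ▸ ⟨e, rfl⟩⟩
      have hf : Function.Bijective f := by
        refine ⟨fun e e' he => hG.2 (congrArg Subtype.val he), fun ⟨z, hz⟩ => ?_⟩
        have hz' := hz
        rw [hr] at hz'
        obtain ⟨e, he⟩ := hz'
        exact ⟨e, Subtype.ext he⟩
      exact ⟨⟨Equiv.ofBijective f hf, fun e => ⟨G e, rfl⟩⟩, rfl⟩
  have hcard : Fintype.card (Fin m ≃ H.edgeSet) = m.factorial := by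
    have : Fintype.card H.edgeSet = m := by
      rw [← hH, ← Nat.card_coe_set_eq, Nat.card_eq_fintype_card]
    rw [Fintype.card_equiv (Fintype.equivFinOfCardEq this).symm, Fintype.card_fin]
  rw [← Nat.card_coe_set_eq, ← Nat.card_eq_of_bijective Φ hΦ, Nat.card_sigma]
  simp only [Nat.card_pi]
  have h2 (σ : Fin m ≃ H.edgeSet) (e : Fin m) :
      Nat.card {p : V × V // s(p.1, p.2) = (σ e : Sym2 V)} = 2 :=
    ncard_sym2_fiber (H.not_isDiag_of_mem_edgeSet (σ e).2)
  simp only [h2, Finset.prod_const, Finset.sum_const, Finset.card_univ, Fintype.card_fin, hcard]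
  rw [smul_eq_mul, mul_comm]

theorem ncard_simple {V : Type*} [Fintype V] (m : ℕ) (𝓠 : Set (SimpleGraph V)) :
    {G : Multigraph V (Fin m) | G.Simple ∧ G.support ∈ 𝓠}.ncard =
      2 ^ m * m.factorial * {H : SimpleGraph V | H ∈ 𝓠 ∧ H.edgeSet.ncard = m}.ncard := by
  classical
  have h1 : {G : Multigraph V (Fin m) | G.Simple ∧ G.support ∈ 𝓠}.ncard =
      (Finset.univ.filter fun G : Multigraph V (Fin m) => G.Simple ∧ G.support ∈ 𝓠).card := by
    rw [← Set.ncard_coe_finset]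
    congr 1
    ext G
    simp
  have h2 : {H : SimpleGraph V | H ∈ 𝓠 ∧ H.edgeSet.ncard = m}.ncard =
      (Finset.univ.filter fun H : SimpleGraph V => H ∈ 𝓠 ∧ H.edgeSet.ncard = m).card := by
    rw [← Set.ncard_coe_finset]
    congr 1
    ext G
    simp
  rw [h1, h2, Finset.card_eq_sum_card_fiberwise (f := support)
    (t := Finset.univ.filter fun H : SimpleGraph V => H ∈ 𝓠 ∧ H.edgeSet.ncard = m), mul_comm,
    ← smul_eq_mul]
  · refine Finset.sum_const_nat fun H hH => ?_
    simp only [Finset.mem_filter, Finset.mem_univ, true_and] at hH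
    rw [← ncard_simple_support_eq hH.2, ← Set.ncard_coe_finset]
    congr 1
    ext G
    simp only [Finset.coe_filter, Finset.mem_filter, Finset.mem_univ, true_and, Set.mem_ofPred_eq]
    constructor
    · rintro ⟨⟨hs, -⟩, h⟩
      exact ⟨hs, h⟩
    · rintro ⟨hs, rfl⟩
      exact ⟨⟨hs, hH.1⟩, rfl⟩
  · intro G hG
    simp only [Finset.coe_filter, Finset.mem_univ, true_and, Set.mem_ofPred_eq] at hG ⊢
    refine ⟨hG.2, ?_⟩
    rw [edgeSet_support hG.1, Set.ncard_range_of_injective hG.1.2, Nat.card_fin]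

theorem ncard_simpleGraph (n m : ℕ) :
    {H : SimpleGraph (Fin n) | H.edgeSet.ncard = m}.ncard = (n.choose 2).choose m := by
  classical
  have h1 : {H : SimpleGraph (Fin n) | H.edgeSet.ncard = m}.ncard =
      (Finset.powersetCard m (Finset.univ.filter fun z : Sym2 (Fin n) => ¬z.IsDiag)).card := by
    rw [← Set.ncard_coe_finset]
    refine Set.ncard_congr (fun H _ => H.edgeFinset) ?_ ?_ ?_
    · intro H hH
      rw [Set.mem_ofPred_eq] at hH
      rw [Finset.mem_coe, Finset.mem_powersetCard]
      refine ⟨fun z hz => ?_, ?_⟩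
      · simpa using H.not_isDiag_of_mem_edgeSet (SimpleGraph.mem_edgeFinset.1 hz)
      · rw [← hH, ← Set.ncard_coe_finset, SimpleGraph.coe_edgeFinset]
    · intro H H' _ _ h
      exact SimpleGraph.edgeFinset_inj.1 h
    · intro B hB
      rw [Finset.mem_coe, Finset.mem_powersetCard] at hB
      have he : (SimpleGraph.fromEdgeSet (B : Set (Sym2 (Fin n)))).edgeSet = B := by
        rw [SimpleGraph.edgeSet_fromEdgeSet]
        ext z
        constructor
        · exact fun hz => hz.1
        · intro hz
          refine ⟨hz, ?_⟩
          simpa using hB.1 hz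
      refine ⟨SimpleGraph.fromEdgeSet B, ?_, ?_⟩
      · rw [Set.mem_ofPred_eq, he, Set.ncard_coe_finset, hB.2]
      · rw [← Finset.coe_inj, SimpleGraph.coe_edgeFinset, he]
  rw [h1, Finset.card_powersetCard]
  congr 1
  rw [← Fintype.card_subtype, Sym2.card_subtype_not_diag, Fintype.card_fin]

theorem ncard_simple_fin (n m : ℕ) : ({G : Multigraph (Fin n) (Fin m) | G.Simple}.ncard : ℚ) =
    2 ^ m * m.factorial * (n.choose 2).choose m := by
  have h := ncard_simple (V := Fin n) m Set.univ
  simp only [Set.mem_univ, and_true, true_and] at h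
  rw [h, ncard_simpleGraph]
  push_cast
  rfl

end Multigraph

/-! ### Graphs weighed as simple multigraphs. -/

/-- The `2^m m!` multigraphs above each graph cancel the denominator of the multigraph weight. -/
theorem sgPos_eq_excessPart (k : ℕ) :
    sgPos k = excessPart k (multigraphGF fun _ _ => {G | G.Simple ∧ G.Pos}) := by
  rw [sgPos]
  congr 1
  ext n m
  rw [graphGF, multigraphGF, PowerSeries.coeff_mk, PowerSeries.coeff_mk, PowerSeries.coeff_mk,
    PowerSeries.coeff_mk]
  have h := Multigraph.ncard_simple (V := Fin n) m {H | GraphPos H}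
  have e : {G : Multigraph (Fin n) (Fin m) | G.Simple ∧ G.Pos} =
      {G | G.Simple ∧ G.support ∈ {H | GraphPos H}} := by
    ext G
    exact and_congr_right fun hG => (Multigraph.graphPos_support_iff hG).symm
  rw [e, h]
  have : (m.factorial : ℚ) ≠ 0 := by positivity
  have : (n.factorial : ℚ) ≠ 0 := by positivity
  push_cast
  field_simp

theorem coeff_sgPos_le (k n : ℕ) :
    PowerSeries.coeff n (sgPos k) ≤ PowerSeries.coeff n (mgPos k) := by
  rw [sgPos_eq_excessPart, mgPos, excessPart, excessPart, PowerSeries.coeff_mk,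
    PowerSeries.coeff_mk, multigraphGF, multigraphGF]
  simp only [PowerSeries.coeff_mk]
  exact div_le_div_of_nonneg_right
    (Nat.cast_le.2 (Set.ncard_le_ncard (fun G hG => hG.2) (Set.toFinite _))) (by positivity)

end ExcessGF

namespace ExcessGF
namespace Multigraph

variable {V E V' E' : Type*}

/-! ### Patchworks: inclusion and exclusion of loops and double edges -/

/-- The image of a pair (vertices, edges). -/
def mapPart (f : V' ↪ V) (g : E' ↪ E) : Finset V' × Finset E' ↪ Finset V × Finset E :=
  (Finset.mapEmbedding f).toEmbedding.prodMap (Finset.mapEmbedding g).toEmbedding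

theorem mapPart_apply (f : V' ↪ V) (g : E' ↪ E) (p : Finset V' × Finset E') :
    mapPart f g p = (p.1.map f, p.2.map g) := rfl

theorem exists_map_mapPart [Fintype V'] [Fintype E'] {f : V' ↪ V} {g : E' ↪ E}
    {P : Finset (Finset V × Finset E)}
    (h : ∀ p ∈ P, (∀ v ∈ p.1, v ∈ Set.range f) ∧ ∀ e ∈ p.2, e ∈ Set.range g) :
    ∃ P' : Finset (Finset V' × Finset E'), P'.map (mapPart f g) = P := by
  classical
  have h1 : P ⊆ Finset.univ.map (mapPart f g) := by
    intro p hp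
    obtain ⟨hV, hE⟩ := h p hp
    obtain ⟨A, -, hA⟩ := Finset.subset_map_iff.1
      (show p.1 ⊆ Finset.univ.map f from fun v hv => by simpa using hV v hv)
    obtain ⟨B, -, hB⟩ := Finset.subset_map_iff.1
      (show p.2 ⊆ Finset.univ.map g from fun e he => by simpa using hE e he)
    exact Finset.mem_map.2 ⟨(A, B), Finset.mem_univ _, Prod.ext hA.symm hB.symm⟩
  obtain ⟨P', -, hP'⟩ := Finset.subset_map_iff.1 h1
  exact ⟨P', hP'.symm⟩

section Extend

variable [DecidableEq E] {A : Finset V} {B : Finset E}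

/-- A multigraph on `A`, `B` together with arbitrary other edges. -/
def extend (G : Multigraph {v // v ∈ A} {e // e ∈ B}) (H : {e // e ∉ B} → V × V) :
    Multigraph V E :=
  fun e => if h : e ∈ B then ((G ⟨e, h⟩).1.1, (G ⟨e, h⟩).2.1) else H ⟨e, h⟩

theorem extend_of_mem (G : Multigraph {v // v ∈ A} {e // e ∈ B}) (H : {e // e ∉ B} → V × V)
    (e : {e // e ∈ B}) : extend G H e = ((G e).1.1, (G e).2.1) := by
  rw [extend, dif_pos e.2]

theorem extend_of_notMem (G : Multigraph {v // v ∈ A} {e // e ∈ B}) (H : {e // e ∉ B} → V × V)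
    (e : {e // e ∉ B}) : extend G H e = H e := by
  rw [extend, dif_neg e.2]

end Extend

variable [DecidableEq V] [DecidableEq E] [DecidableEq V'] [DecidableEq E']

/-- A loop or a double edge. -/
def IsPart (G : Multigraph V E) (p : Finset V × Finset E) : Prop := G.IsLoop p ∨ G.IsDoubleEdge p

theorem isLoop_mapPart {G' : Multigraph V' E'} {G : Multigraph V E} {f : V' ↪ V} {g : E' ↪ E}
    (h : ∀ e, G (g e) = (f (G' e).1, f (G' e).2)) (p : Finset V' × Finset E') :
    G.IsLoop (mapPart f g p) ↔ G'.IsLoop p := by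
  constructor
  · rintro ⟨v, e, he, hp⟩
    rw [mapPart_apply, Prod.mk.injEq] at hp
    obtain ⟨v', -, rfl⟩ := Finset.mem_map.1 (hp.1 ▸ Finset.mem_singleton_self v)
    obtain ⟨e', -, rfl⟩ := Finset.mem_map.1 (hp.2 ▸ Finset.mem_singleton_self e)
    rw [← Finset.map_singleton, ← Finset.map_singleton, Finset.map_inj, Finset.map_inj] at hp
    rw [h, Prod.mk.injEq, f.apply_eq_iff_eq, f.apply_eq_iff_eq] at he
    exact ⟨v', e', Prod.ext he.1 he.2, Prod.ext hp.1 hp.2⟩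
  · rintro ⟨v, e, he, rfl⟩
    refine ⟨f v, g e, by rw [h, he], ?_⟩
    rw [mapPart_apply, Finset.map_singleton, Finset.map_singleton]

theorem isDoubleEdge_mapPart {G' : Multigraph V' E'} {G : Multigraph V E} {f : V' ↪ V}
    {g : E' ↪ E} (h : ∀ e, G (g e) = (f (G' e).1, f (G' e).2)) (p : Finset V' × Finset E') :
    G.IsDoubleEdge (mapPart f g p) ↔ G'.IsDoubleEdge p := by
  have key (e : E') (v w : V') : G (g e) = (f v, f w) ↔ G' e = (v, w) := by
    rw [h, Prod.mk.injEq, f.apply_eq_iff_eq, f.apply_eq_iff_eq, Prod.ext_iff]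
  constructor
  · rintro ⟨v, w, e₁, e₂, hvw, hee, h₁, h₂, hp⟩
    rw [mapPart_apply, Prod.mk.injEq] at hp
    obtain ⟨v, -, rfl⟩ := Finset.mem_map.1 (hp.1 ▸ Finset.mem_insert_self v {w})
    obtain ⟨w, -, rfl⟩ := Finset.mem_map.1
      (hp.1 ▸ Finset.mem_insert_of_mem (Finset.mem_singleton_self w))
    obtain ⟨e₁, -, rfl⟩ := Finset.mem_map.1 (hp.2 ▸ Finset.mem_insert_self e₁ {e₂})
    obtain ⟨e₂, -, rfl⟩ := Finset.mem_map.1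
      (hp.2 ▸ Finset.mem_insert_of_mem (Finset.mem_singleton_self e₂))
    rw [← Finset.map_singleton, ← Finset.map_singleton, ← Finset.map_insert, ← Finset.map_insert,
      Finset.map_inj, Finset.map_inj] at hp
    rw [key, key] at h₁ h₂
    exact ⟨v, w, e₁, e₂, fun hh => hvw (by rw [hh]), fun hh => hee (by rw [hh]), h₁, h₂,
      Prod.ext hp.1 hp.2⟩
  · rintro ⟨v, w, e₁, e₂, hvw, hee, h₁, h₂, rfl⟩
    refine ⟨f v, f w, g e₁, g e₂, f.injective.ne hvw, g.injective.ne hee, ?_, ?_, ?_⟩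
    · rwa [key, key]
    · rwa [key, key]
    · rw [mapPart_apply, Finset.map_insert, Finset.map_insert, Finset.map_singleton,
        Finset.map_singleton]

theorem isPart_mapPart {G' : Multigraph V' E'} {G : Multigraph V E} {f : V' ↪ V} {g : E' ↪ E}
    (h : ∀ e, G (g e) = (f (G' e).1, f (G' e).2)) (p : Finset V' × Finset E') :
    G.IsPart (mapPart f g p) ↔ G'.IsPart p :=
  or_congr (isLoop_mapPart h p) (isDoubleEdge_mapPart h p)

theorem IsPart.ends_mem {G : Multigraph V E} {p : Finset V × Finset E} (h : G.IsPart p) {e : E}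
    (he : e ∈ p.2) : (G e).1 ∈ p.1 ∧ (G e).2 ∈ p.1 := by
  rcases h with ⟨v, e', h1, rfl⟩ | ⟨v, w, e₁, e₂, -, -, h₁, h₂, rfl⟩
  · obtain rfl := Finset.mem_singleton.1 he
    simp [h1]
  · rcases Finset.mem_insert.1 he with rfl | he
    · rcases h₁ with h | h <;> simp [h]
    · obtain rfl := Finset.mem_singleton.1 he
      rcases h₂ with h | h <;> simp [h]

/-- Loops and double edges are the forbidden configurations of the inclusion and exclusion. -/
theorem simple_iff_not_isPart {G : Multigraph V E} : G.Simple ↔ ∀ p, ¬G.IsPart p := by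
  constructor
  · rintro hG p (⟨v, e, he, -⟩ | ⟨v, w, e₁, e₂, -, hne, h₁, h₂, -⟩)
    · exact hG.1 e (by rw [he])
    · refine hne (hG.2 ?_)
      dsimp only
      rcases h₁ with h₁ | h₁ <;> rcases h₂ with h₂ | h₂ <;> rw [h₁, h₂]
      · exact Sym2.eq_swap
      · exact Sym2.eq_swap
  · intro h
    have h1 : ∀ e, (G e).1 ≠ (G e).2 := fun e he =>
      h _ (Or.inl ⟨(G e).1, e, Prod.ext rfl he.symm, rfl⟩)
    refine ⟨h1, fun e₁ e₂ he => ?_⟩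
    by_contra hne
    refine h _ (Or.inr ⟨(G e₁).1, (G e₁).2, e₁, e₂, h1 e₁, hne, Or.inl rfl, ?_, rfl⟩)
    rcases Sym2.eq_iff.1 he with ⟨h₁, h₂⟩ | ⟨h₁, h₂⟩
    · exact Or.inl (Prod.ext h₁.symm h₂.symm)
    · exact Or.inr (Prod.ext h₂.symm h₁.symm)

theorem isPatchwork_relabel (α : V' ≃ V) (β : E' ≃ E) (G : Multigraph V' E')
    (P : Finset (Finset V' × Finset E')) :
    IsPatchwork (relabel α β G) (P.map (mapPart α.toEmbedding β.toEmbedding)) ↔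
      IsPatchwork G P := by
  refine and_congr ?_ (and_congr ?_ ?_)
  · rw [Finset.forall_mem_map]
    exact forall₂_congr fun p _ => isPart_mapPart (f := α.toEmbedding) (g := β.toEmbedding)
      (relabel_apply α β G) p
  · rw [← α.forall_congr_right]
    simp [mapPart_apply]
  · rw [← β.forall_congr_right]
    simp [mapPart_apply]

/-! ### Signed counts of patchworks. -/

variable [Fintype V] [Fintype E] [Fintype V'] [Fintype E']

open Classical in
variable (V E) in
/-- The number of patchworks on `V` and `E`, with signs. -/
noncomputable def patchSign : ℤ :=
  ∑ GP : Multigraph V E × Finset (Finset V × Finset E) with IsPatchwork GP.1 GP.2,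
    (-1) ^ GP.2.card

theorem patchSign_congr (α : V' ≃ V) (β : E' ≃ E) : patchSign V' E' = patchSign V E := by
  classical
  refine Finset.sum_bij
    (fun GP _ => (relabel α β GP.1, GP.2.map (mapPart α.toEmbedding β.toEmbedding))) ?_ ?_ ?_ ?_
  · rintro ⟨G, P⟩ h
    simpa [isPatchwork_relabel] using h
  · rintro ⟨G, P⟩ - ⟨G', P'⟩ - h
    rw [Prod.mk.injEq, (relabel α β).apply_eq_iff_eq, Finset.map_inj] at h
    exact Prod.ext h.1 h.2
  · rintro ⟨G, P⟩ h
    obtain ⟨G, rfl⟩ := (relabel α β).surjective G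
    obtain ⟨P, rfl⟩ := exists_map_mapPart (f := α.toEmbedding) (g := β.toEmbedding) (P := P)
      fun p _ => ⟨fun v _ => α.surjective v, fun e _ => β.surjective e⟩
    exact ⟨(G, P), by simpa [isPatchwork_relabel] using h, rfl⟩
  · rintro ⟨G, P⟩ -
    rw [Finset.card_map]

/-- The parts determine a patchwork on the vertices `A` and edges `B` they cover; each edge outside
`B` may be any ordered pair of vertices of `V`, including those of `A`. -/
theorem sum_fiber_eq_patchSign_mul (A : Finset V) (B : Finset E)
    [DecidablePred fun GP : Multigraph V E × Finset (Finset V × Finset E) =>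
      (∀ p ∈ GP.2, GP.1.IsPart p) ∧ GP.2.biUnion Prod.fst = A ∧ GP.2.biUnion Prod.snd = B] :
    ∑ GP : Multigraph V E × Finset (Finset V × Finset E) with
        (∀ p ∈ GP.2, GP.1.IsPart p) ∧ GP.2.biUnion Prod.fst = A ∧ GP.2.biUnion Prod.snd = B,
      (-1 : ℤ) ^ GP.2.card =
    patchSign {v // v ∈ A} {e // e ∈ B} *
      Fintype.card ({e // e ∉ B} → V × V) := by
  classical
  let ι : Finset {v // v ∈ A} × Finset {e // e ∈ B} ↪ Finset V × Finset E :=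
    mapPart (Function.Embedding.subtype _) (Function.Embedding.subtype _)
  symm
  rw [patchSign, ← nsmul_one (Fintype.card _), ← Finset.card_univ, ← Finset.sum_const,
    Finset.sum_mul_sum, ← Finset.sum_product']
  refine Finset.sum_bij (fun x _ => (extend x.1.1 x.2, x.1.2.map ι)) ?_ ?_ ?_ ?_
  · rintro ⟨⟨G, P⟩, H⟩ h
    simp only [Finset.mem_product, Finset.mem_filter, Finset.mem_univ, true_and, and_true] at h ⊢
    obtain ⟨h1, h2, h3⟩ := h
    refine ⟨?_, ?_, ?_⟩
    · rw [Finset.forall_mem_map]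
      exact fun p hp => (isPart_mapPart (extend_of_mem G H) p).2 (h1 p hp)
    · ext v
      simp only [Finset.mem_biUnion, Finset.mem_map]
      constructor
      · rintro ⟨_, ⟨p, -, rfl⟩, hv⟩
        obtain ⟨w, -, rfl⟩ := Finset.mem_map.1 hv
        exact w.2
      · intro hv
        obtain ⟨p, hp, hvp⟩ := h2 ⟨v, hv⟩
        exact ⟨_, ⟨p, hp, rfl⟩, Finset.mem_map.2 ⟨_, hvp, rfl⟩⟩
    · ext e
      simp only [Finset.mem_biUnion, Finset.mem_map]
      constructor
      · rintro ⟨_, ⟨p, -, rfl⟩, he⟩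
        obtain ⟨w, -, rfl⟩ := Finset.mem_map.1 he
        exact w.2
      · intro he
        obtain ⟨p, hp, hep⟩ := h3 ⟨e, he⟩
        exact ⟨_, ⟨p, hp, rfl⟩, Finset.mem_map.2 ⟨_, hep, rfl⟩⟩
  · rintro ⟨⟨G, P⟩, H⟩ - ⟨⟨G', P'⟩, H'⟩ - h
    rw [Prod.mk.injEq, Finset.map_inj] at h
    obtain ⟨hG, rfl⟩ := h
    have e1 : G = G' := by
      funext e
      have := congrFun hG e
      rw [extend_of_mem, extend_of_mem, Prod.mk.injEq] at this
      exact Prod.ext (Subtype.ext this.1) (Subtype.ext this.2)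
    have e2 : H = H' := by
      funext e
      have := congrFun hG e
      rwa [extend_of_notMem, extend_of_notMem] at this
    rw [e1, e2]
  · rintro ⟨G, P⟩ h
    rw [Finset.mem_filter] at h
    obtain ⟨-, h1, rfl, rfl⟩ := h
    dsimp only at h1
    -- Both ends of an edge of a part lie in that part, so the restriction of `G` to `A` and `B`
    -- makes sense.
    have hends (e : {e // e ∈ P.biUnion Prod.snd}) :
        (G e).1 ∈ P.biUnion Prod.fst ∧ (G e).2 ∈ P.biUnion Prod.fst := by
      obtain ⟨p, hp, he⟩ := Finset.mem_biUnion.1 e.2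
      have := (h1 p hp).ends_mem he
      exact ⟨Finset.mem_biUnion.2 ⟨p, hp, this.1⟩, Finset.mem_biUnion.2 ⟨p, hp, this.2⟩⟩
    let G' : Multigraph {v // v ∈ P.biUnion Prod.fst} {e // e ∈ P.biUnion Prod.snd} :=
      fun e => (⟨_, (hends e).1⟩, ⟨_, (hends e).2⟩)
    obtain ⟨P', hP'⟩ := exists_map_mapPart (P := P)
      (f := Function.Embedding.subtype fun v => v ∈ P.biUnion Prod.fst)
      (g := Function.Embedding.subtype fun e => e ∈ P.biUnion Prod.snd)
      fun p hp => ⟨fun v hv => ⟨⟨v, Finset.mem_biUnion.2 ⟨p, hp, hv⟩⟩, rfl⟩,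
        fun e he => ⟨⟨e, Finset.mem_biUnion.2 ⟨p, hp, he⟩⟩, rfl⟩⟩
    have hmem (p) (hp : p ∈ P) : ∃ p' ∈ P', ι p' = p := by
      rw [← hP'] at hp
      exact Finset.mem_map.1 hp
    refine ⟨((G', P'), fun e => G e), ?_, ?_⟩
    · simp only [Finset.mem_product, Finset.mem_filter, Finset.mem_univ, true_and, and_true]
      refine ⟨fun p hp => ?_, fun v => ?_, fun e => ?_⟩
      · refine (isPart_mapPart (G := G) (f := Function.Embedding.subtype _)
          (g := Function.Embedding.subtype _) (fun e => rfl) p).1 (h1 _ ?_)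
        exact (Finset.ext_iff.1 hP' _).1 (Finset.mem_map_of_mem _ hp)
      · obtain ⟨p, hp, hv⟩ := Finset.mem_biUnion.1 v.2
        obtain ⟨p', hp', rfl⟩ := hmem p hp
        refine ⟨p', hp', ?_⟩
        obtain ⟨w, hw, hwv⟩ := Finset.mem_map.1 hv
        exact Subtype.ext hwv ▸ hw
      · obtain ⟨p, hp, hv⟩ := Finset.mem_biUnion.1 e.2
        obtain ⟨p', hp', rfl⟩ := hmem p hp
        refine ⟨p', hp', ?_⟩
        obtain ⟨w, hw, hwv⟩ := Finset.mem_map.1 hv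
        exact Subtype.ext hwv ▸ hw
    · refine Prod.ext (funext fun e => ?_) hP'
      by_cases he : e ∈ P.biUnion Prod.snd
      · exact extend_of_mem G' (fun e => G e) ⟨e, he⟩
      · exact extend_of_notMem G' (fun e => G e) ⟨e, he⟩
  · rintro ⟨⟨G, P⟩, H⟩ -
    rw [Finset.card_map, mul_one]

/-- Inclusion and exclusion: replace the indicator of "no part" by the alternating sum over sets of
parts, exchange sums, and group by the covered vertices and edges. -/
theorem ncard_simple_eq_sum_patchSign :
    ({G : Multigraph V E | G.Simple}.ncard : ℤ) = ∑ A : Finset V, ∑ B : Finset E,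
      patchSign {v // v ∈ A} {e // e ∈ B} * Fintype.card ({e // e ∉ B} → V × V) := by
  classical
  have h1 : ({G : Multigraph V E | G.Simple}.ncard : ℤ) =
      ∑ G : Multigraph V E, ∑ P ∈ (Finset.univ.filter fun p => G.IsPart p).powerset,
        (-1 : ℤ) ^ P.card := by
    have : {G : Multigraph V E | G.Simple}.ncard =
        (Finset.univ.filter fun G : Multigraph V E => G.Simple).card := by
      rw [← Set.ncard_coe_finset]
      congr 1
      ext G
      simp
    rw [this, Finset.card_filter]
    push_cast
    refine Finset.sum_congr rfl fun G _ => ?_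
    -- The alternating sum over all sets of parts is 1 if there is no part and 0 otherwise.
    rw [Finset.sum_powerset_neg_one_pow_card]
    refine if_congr ?_ rfl rfl
    rw [simple_iff_not_isPart, Finset.filter_eq_empty_iff]
    simp
  have h2 : ∑ G : Multigraph V E, ∑ P ∈ (Finset.univ.filter fun p => G.IsPart p).powerset,
        (-1 : ℤ) ^ P.card =
      ∑ GP : Multigraph V E × Finset (Finset V × Finset E) with ∀ p ∈ GP.2, GP.1.IsPart p,
        (-1 : ℤ) ^ GP.2.card := by
    rw [Finset.sum_filter, Fintype.sum_prod_type]
    refine Finset.sum_congr rfl fun G _ => ?_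
    rw [← Finset.sum_filter]
    refine Finset.sum_congr ?_ fun _ _ => rfl
    ext P
    simp [Finset.subset_iff]
  rw [h1, h2, ← Finset.sum_fiberwise _
    (fun GP => (GP.2.biUnion Prod.fst, GP.2.biUnion Prod.snd)), Fintype.sum_prod_type]
  refine Finset.sum_congr rfl fun A _ => Finset.sum_congr rfl fun B _ => ?_
  rw [← sum_fiber_eq_patchSign_mul, Finset.filter_filter]
  simp only [Prod.mk.injEq]

theorem ncard_simple_fin_eq_sum_patchSign (n m : ℕ) :
    ({G : Multigraph (Fin n) (Fin m) | G.Simple}.ncard : ℚ) =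
      ∑ a ∈ Finset.range (n + 1), ∑ b ∈ Finset.range (m + 1), (n.choose a : ℚ) *
        ((m.choose b : ℚ) * ((patchSign (Fin a) (Fin b) : ℚ) * ((n : ℚ) ^ 2) ^ (m - b))) := by
  have h := congrArg (Int.cast : ℤ → ℚ)
    (ncard_simple_eq_sum_patchSign (V := Fin n) (E := Fin m))
  have h1 (A : Finset (Fin n)) (B : Finset (Fin m)) :
      patchSign {v // v ∈ A} {e // e ∈ B} = patchSign (Fin A.card) (Fin B.card) :=
    patchSign_congr (Fintype.equivFinOfCardEq (Fintype.card_coe A))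
      (Fintype.equivFinOfCardEq (Fintype.card_coe B))
  have h2 (B : Finset (Fin m)) : Fintype.card ({e // e ∉ B} → Fin n × Fin n) =
      (n ^ 2) ^ (m - B.card) := by
    rw [Fintype.card_fun, Fintype.card_subtype_compl, Fintype.card_coe, Fintype.card_fin,
      Fintype.card_prod, Fintype.card_fin, sq]
  have h3 (F : ℕ → ℚ) (N : ℕ) : ∑ A : Finset (Fin N), F A.card =
      ∑ a ∈ Finset.range (N + 1), (N.choose a : ℚ) * F a := by
    rw [← Finset.powerset_univ, Finset.sum_powerset_apply_card, Finset.card_univ, Fintype.card_fin]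
    simp
  simp only [h1, h2] at h
  push_cast at h
  rw [h]
  have h4 (A : Finset (Fin n)) := h3
    (fun b => (patchSign (Fin A.card) (Fin b) : ℚ) * ((n : ℚ) ^ 2) ^ (m - b)) m
  simp only [h4]
  rw [h3 fun a => ∑ b ∈ Finset.range (m + 1), (m.choose b : ℚ) *
    ((patchSign (Fin a) (Fin b) : ℚ) * ((n : ℚ) ^ 2) ^ (m - b))]
  simp only [Finset.mul_sum]

end Multigraph
end ExcessGF

namespace ExcessGF
open PowerSeries

/-! ### The patchwork series at `u = -1`. -/

/-- The generating function of patchworks with `u = -1`. -/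
noncomputable def signedPatchworkGF : ℚ⟦X⟧⟦X⟧ :=
  countGF fun n m => (Multigraph.patchSign (Fin n) (Fin m) : ℚ)

theorem patchworkPartAt_neg_one (l : ℕ) :
    patchworkPartAt l (-1) = excessPart l signedPatchworkGF := by
  ext n
  rw [patchworkPartAt, coeff_map, patchworkPart, excessPart, coeff_mk, excessPart, coeff_mk,
    patchworkGF, coeff_mk, coeff_mk, signedPatchworkGF, coeff_countGF, map_sum,
    Multigraph.patchSign]
  push_cast
  rw [Finset.sum_div]
  refine Finset.sum_congr rfl fun GP _ => ?_
  rw [Polynomial.coe_evalRingHom, Polynomial.eval_monomial]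
  ring

/-- Both sides count simple multigraphs on `n` vertices: directly through graphs, and by inclusion
and exclusion, the `n²` choices for each free edge forming `e^(wn²/2)`. -/
theorem isCorrection_signedPatchworkGF : IsCorrection signedPatchworkGF := by
  intro n
  ext m
  have hc : coeff m (C (1 / (n.factorial : ℚ)) * (1 + X : ℚ⟦X⟧) ^ n.choose 2) =
      ({G : Multigraph (Fin n) (Fin m) | G.Simple}.ncard : ℚ) /
        (2 ^ m * m.factorial * n.factorial) := by
    rw [coeff_C_mul, coeff_one_add_X_pow, Multigraph.ncard_simple_fin]
    have : (m.factorial : ℚ) ≠ 0 := by positivity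
    field_simp
  rw [hc, Multigraph.ncard_simple_fin_eq_sum_patchSign, Finset.mul_sum, map_sum, Finset.sum_div]
  refine Finset.sum_congr rfl fun a ha => ?_
  rw [mul_left_comm, coeff_C_mul, mul_comm (rescale _ _), coeff_mul,
    Finset.Nat.sum_antidiagonal_eq_sum_range_succ fun i j =>
      coeff i (coeff a signedPatchworkGF) * coeff j (rescale ((n : ℚ) ^ 2 / 2) (exp ℚ)),
    Finset.mul_sum, Finset.sum_div]
  refine Finset.sum_congr rfl fun b hb => ?_
  have ha := Nat.lt_succ_iff.1 (Finset.mem_range.1 ha)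
  obtain ⟨b', rfl⟩ := Nat.exists_eq_add_of_le (Nat.lt_succ_iff.1 (Finset.mem_range.1 hb))
  rw [signedPatchworkGF, coeff_countGF, coeff_rescale, coeff_exp, Nat.cast_choose ℚ ha,
    Nat.cast_choose ℚ (Nat.le_add_right b b'), Nat.add_sub_cancel_left]
  simp only [Algebra.algebraMap_self, RingHom.id_apply]
  have h1 : (n.factorial : ℚ) ≠ 0 := by positivity
  have h2 : ((b + b').factorial : ℚ) ≠ 0 := by positivity
  have h3 : (b'.factorial : ℚ) ≠ 0 := by positivity
  rw [pow_add, div_pow]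
  field_simp

theorem sgPos_eq (k : ℕ) :
    sgPos k = (exp ℚ).subst (-unicycle) * graphCore signedPatchworkGF k := by
  rw [sgPos_eq_excessPart,
    excessPart_simple_eq isCorrection_signedPatchworkGF Multigraph.ncard_simple_fin]

end ExcessGF

/-! ### The closed formulas. -/

theorem mainTheorem4 (k : ℕ) :
    ExcessGF.sgPos k =
        ∑ l ∈ Finset.range (k + 1),
          ExcessGF.oddDoubleFactorial (k - l) •
            ExcessGF.innerCoeff (2 * (k - l))
              (ExcessGF.patchworkSubst l *
                ExcessGF.inZ ((PowerSeries.exp ℚ).subst (-ExcessGF.unicycle)) *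
                ExcessGF.denomPow (-(((k - l : ℕ) : ℚ) + 1 / 2))) ∧
      ExcessGF.mgPos k =
        ExcessGF.oddDoubleFactorial k •
          ExcessGF.innerCoeff (2 * k)
            (ExcessGF.inZ ((PowerSeries.exp ℚ).subst (-ExcessGF.multiUnicycle)) *
              ExcessGF.denomPow (-((k : ℚ) + 1 / 2))) ∧
      ∀ n : ℕ,
        PowerSeries.coeff n (ExcessGF.sgPos k) ≤ PowerSeries.coeff n (ExcessGF.mgPos k) := by
  refine ⟨?_, ?_, ExcessGF.coeff_sgPos_le k⟩
  · rw [ExcessGF.sgPos_eq, ExcessGF.graphCore, Finset.mul_sum]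
    refine Finset.sum_congr rfl fun l _ => ?_
    rw [ExcessGF.weightedCore, ← ExcessGF.patchworkPartAt_neg_one, mul_smul_comm,
      ← ExcessGF.innerCoeff_inZ_mul, ← mul_assoc, mul_comm (ExcessGF.inZ _), ExcessGF.patchworkSubst]
  · rw [ExcessGF.mgPos_eq, ExcessGF.corePart, mul_smul_comm, ← ExcessGF.innerCoeff_inZ_mul]
    -- At `a = 0` the weight `e^(ax)` disappears.
    have h : ExcessGF.inX (PowerSeries.rescale 0 (PowerSeries.exp ℚ)) = 1 := by
      simp [ExcessGF.inX]
    rw [h, one_mul]
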